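/- Let $(\Omega,\mathcal F,\mathbb P)$ be a probability space, $m$ a probability measure on $[0,1]$, $x>0$, $\rho$ an integrable random variable with $\rho>0$ almost surely, $\delta:=\mathbb E[\rho]$, $A$ a real random variable, and $C$ a bivariate copula. For a real random variable $X$ let $F_X$ be its CDF and $F_X^{-1}(z)=\inf\{r: F_X(r)>z\}$, $z\in(0,1)$, its right-continuous quantile function, with $F_X^{-1}(0):=\lim_{z\downarrow0}F_X^{-1}(z)$ and $F_X^{-1}(1):=\lim_{z\uparrow1}F_X^{-1}(z)$. Consider the problem $$\text{maximize } V(X)=\int_{[0,1]}F_X^{-1}(z)\,m(dz)\quad\text{subject to}\quad \mathbb E[\rho X]\le x,\quad X\ge 0,\quad \mathbb P(X\le t,\,A\le a)=C(F_X(t),F_A(a))\ \ \forall\, t,a\in\mathbb R,$$ where $V$ takes values in $[0,\infty]$ and $X\geq 0$ is meant almost surely. Assume that, for almost every value $a$ of $A$, the conditional CDF $F_{\rho|A}(\cdot,a)$ of $\rho$ given $A=a$ is continuous, and that $F_A$ is continuous. Let $C_{1|2}^{-1}(\cdot,v)$ be the right-continuous quantile function of the conditional law of the first component of a random vector with joint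 CDF $C$, given that the second component equals $v$. Put $$Z:=C^{-1}_{1|2}\bigl(1-F_{\rho|A}(\rho,A),F_A(A)\bigr),\qquad \varphi(z):=\mathbb E[\rho\mid Z=z],$$ $$\tilde\zeta(c):=\frac{m([c,1])}{\int_c^1\varphi(z)\,dz}\quad(c\in(0,1)),\qquad \tilde\gamma^*:=\sup_{c\in(0,1)}\tilde\zeta(c)\in[0,\infty].$$ Then the optimal value of the problem is $\max(1/\delta,\tilde\gamma^*)\,x$. Furthermore: (i) If $\tilde\gamma^*=+\infty$, there exist $c_n\in(0,1)$ with $c_n\to1$ such that $X_n:=k_n\mathbf 1_{Z\ge c_n}$ with $k_n:=x/\mathbb E[\rho\mathbf 1_{Z\ge c_n}]$ is feasible for every $n$ and $V(X_n)\to+\infty$. (ii) If $\tilde\gamma^*\le1/\delta$, the constant $X^*\equiv x/\delta$ is optimal. (iii) If $1/\delta<\tilde\gamma^*<+\infty$ and the supremum is attained at $c^*\in(0,1)$, then $X^*:=k^*\mathbf 1_{Z\ge c^*}$ with $k^*:=x/\mathbb E[\rho\mathbf 1_{Z\ge c^*}]$ is optimal; if $c^*$ is the only point of $(0,1)$ at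 which the supremum is attained, then $X^*$ is the unique optimal solution, up to almost sure equality. (iv) If $1/\delta<\tilde\gamma^*<+\infty$ and the supremum is not attained in $(0,1)$, there is no optimal solution. Furthermore, for any $c_n\in(0,1)$ with $\tilde\zeta(c_n)\to\tilde\gamma^*$, $X_n:=k_n\mathbf 1_{Z\ge c_n}$ with $k_n:=x/\mathbb E[\rho\mathbf 1_{Z\ge c_n}]$ is feasible for every $n$, and $V(X_n)$ converges to the optimal value. -/

import Mathlib

open MeasureTheory ProbabilityTheory Set Filter Topology
open scoped ENNReal

noncomputable section

namespace DualPayoff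

/-- The right-continuous inverse `inf {r : F(r) > z}` of the CDF `F` of `μ`, at a level
`z` in the open interval `(0, 1)`, where the set is non-empty and bounded below. -/
def quantileInner (μ : Measure ℝ) (z : ℝ) : ℝ :=
  sInf {r : ℝ | z < cdf μ r}

/-- The right-continuous quantile function of a probability measure `μ` on `ℝ`, on `[0, 1]`.
The values at `0` and at `1` are the monotone limits from inside `(0, 1)`; they may be infinite. -/
def quantile (μ : Measure ℝ) (z : ℝ) : EReal :=
  if z ≤ 0 then ⨅ y ∈ Ioo (0 : ℝ) 1, (quantileInner μ y : EReal)
  else if 1 ≤ z then ⨆ y ∈ Ioo (0 : ℝ) 1, (quantileInner μ y : EReal)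
  else (quantileInner μ z : EReal)

/-- A bivariate copula, given by the law on `ℝ × ℝ` of a random vector whose two components
are uniform on `[0, 1]`. The copula function is the joint CDF of this law, `Copula.fn`. -/
structure Copula where
  /-- the law of the random vector -/
  law : Measure (ℝ × ℝ)
  isProb : IsProbabilityMeasure law
  map_fst : law.map Prod.fst = volume.restrict (Icc (0 : ℝ) 1)
  map_snd : law.map Prod.snd = volume.restrict (Icc (0 : ℝ) 1)

instance (C : Copula) : IsProbabilityMeasure C.law := C.isProb

/-- The copula function `C(u, v)`. -/
def Copula.fn (C : Copula) (u v : ℝ) : ℝ := C.law.real (Iic u ×ˢ Iic v)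

/-- The conditional law of the first component of the copula, given that the second one is `v`. -/
def Copula.condFst (C : Copula) (v : ℝ) : Measure ℝ :=
  condDistrib (Prod.fst : ℝ × ℝ → ℝ) (Prod.snd : ℝ × ℝ → ℝ) C.law v

variable {Ω : Type*} [MeasurableSpace Ω]

/-- The preference value `V(X) = ∫_{[0,1]} F_X⁻¹(z) m(dz)` of a payoff `X` with `X ≥ 0` almost
surely (then `F_X⁻¹` takes values in `[0, ∞]` and the integral always exists in `[0, ∞]`). -/
def prefValue (P : Measure Ω) (m : Measure ℝ) (X : Ω → ℝ) : ℝ≥0∞ :=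
  ∫⁻ z in Icc (0 : ℝ) 1, (quantile (P.map X) z).toENNReal ∂m

/-- `X` and `A` have the joint distribution `P(X ≤ t, A ≤ a) = C(F_X(t), F_A(a))`. -/
def HasCopula (P : Measure Ω) (C : Copula) (X A : Ω → ℝ) : Prop :=
  ∀ t a : ℝ, P.real {ω | X ω ≤ t ∧ A ω ≤ a} = C.fn (cdf (P.map X) t) (cdf (P.map A) a)

/-- Feasible payoffs with initial wealth `x`: `X ≥ 0`, `E[ρ X] ≤ x`, and `X` has copula `C`
with the benchmark `A`. -/
structure Feasible (P : Measure Ω) (ρ A : Ω → ℝ) (C : Copula) (x : ℝ) (X : Ω → ℝ) : Prop where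
  measurable : Measurable X
  nonneg : ∀ᵐ ω ∂P, 0 ≤ X ω
  integrable : Integrable (fun ω => ρ ω * X ω) P
  budget : ∫ ω, ρ ω * X ω ∂P ≤ x
  copula : HasCopula P C X A

/-- The optimal value of the problem, in `[0, ∞]`. -/
def optimalValue (P : Measure Ω) (m : Measure ℝ) (ρ A : Ω → ℝ) (C : Copula) (x : ℝ) : ℝ≥0∞ :=
  ⨆ X ∈ {X : Ω → ℝ | Feasible P ρ A C x X}, prefValue P m X

/-- `X` is an optimal solution of the problem. -/
def IsOptimal (P : Measure Ω) (m : Measure ℝ) (ρ A : Ω → ℝ) (C : Copula) (x : ℝ)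
    (X : Ω → ℝ) : Prop :=
  Feasible P ρ A C x X ∧ ∀ Y : Ω → ℝ, Feasible P ρ A C x Y → prefValue P m Y ≤ prefValue P m X

/-- The conditional CDF `F_{ρ|A}(r, a)`. -/
def condCdf (P : Measure Ω) [IsProbabilityMeasure P] (ρ A : Ω → ℝ) (r a : ℝ) : ℝ :=
  cdf (condDistrib ρ A P a) r

/-- The random variable `Z = C_{1|2}⁻¹(1 - F_{ρ|A}(ρ, A), F_A(A))`. -/
def zVar (P : Measure Ω) [IsProbabilityMeasure P] (ρ A : Ω → ℝ) (C : Copula) (ω : Ω) : ℝ :=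
  (quantile (C.condFst (cdf (P.map A) (A ω))) (1 - condCdf P ρ A (ρ ω) (A ω))).toReal

/-- `φ(z) = E[ρ | Z = z]`, the mean of the conditional law of `ρ` given `Z = z`. -/
def phi (P : Measure Ω) [IsProbabilityMeasure P] (ρ A : Ω → ℝ) (C : Copula) (z : ℝ) : ℝ :=
  ∫ r, r ∂(condDistrib ρ (zVar P ρ A C) P z)

/-- `ζ̃(c) = m([c, 1]) / ∫_c^1 φ(z) dz`. -/
def zeta (P : Measure Ω) [IsProbabilityMeasure P] (m : Measure ℝ) (ρ A : Ω → ℝ) (C : Copula)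
    (c : ℝ) : ℝ :=
  m.real (Icc c 1) / ∫ z in c..1, phi P ρ A C z

/-- `γ̃* = sup_{c ∈ (0, 1)} ζ̃(c)`, in `[0, ∞]`. -/
def gammaStar (P : Measure Ω) [IsProbabilityMeasure P] (m : Measure ℝ) (ρ A : Ω → ℝ)
    (C : Copula) : ℝ≥0∞ :=
  ⨆ c ∈ Ioo (0 : ℝ) 1, ENNReal.ofReal (zeta P m ρ A C c)

/-- The digital payoff `k 1_{Z ≥ c}` with `k = x / E[ρ 1_{Z ≥ c}]`. -/
def digital (P : Measure Ω) [IsProbabilityMeasure P] (ρ A : Ω → ℝ) (C : Copula) (x c : ℝ) :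
    Ω → ℝ :=
  {ω | c ≤ zVar P ρ A C ω}.indicator
    (fun _ => x / ∫ ω in {ω | c ≤ zVar P ρ A C ω}, ρ ω ∂P)

end DualPayoff

end

/-!
Everything is expressed through layers. Let `F` be the CDF of a payoff `X ≥ 0`. Since
`F⁻¹(z) > t` means `F(t) ≤ z` up to a single value of `t`, Tonelli gives

  `V(X) = ∫_{t > 0, F(t) < 1} m([F(t), 1]) dt`  (`prefValue_eq`),

while `E[ρ X] = ∫_{t > 0} E[ρ 1_{X > t}] dt` (`IsMarket.lintegral_kernel_mul`). The two integrands
are compared for each `t` separately.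

The probability integral transform, applied conditionally on `A`, shows that `(Z, F_A(A))` has the
law of the copula (`IsMarket.measure_zVar_mem`). Hence `{X > t}` and `{Z ≥ F(t)}` have the same
conditional probability given `A`, for every feasible `X` (`HasCopula.measure_inter`). Given `A`,
the variable `Z` is a non-increasing function of `ρ`, so `{Z ≥ c} = {ρ ≤ h(A)}` for some `h`
(`IsMarket.exists_threshold`). By a conditional Neyman–Pearson argument
(`lintegral_le_of_threshold`) the price `E[ρ 1_{X > t}]` is at least
`E[ρ 1_{Z ≥ F(t)}] = ∫_{F(t)}^1 φ`, with equality only if the two events agree almost surely.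

By the definition of `γ̃*`, with `1/δ` accounting for `c = 0`, the weight `m([c, 1])` is at most
`max(1/δ, γ̃*) ∫_c^1 φ` for `c ∈ [0, 1)`. Integrating over `t` yields
`V(X) ≤ max(1/δ, γ̃*) E[ρ X] ≤ max(1/δ, γ̃*) x` (`IsMarket.prefValue_le`). Constants and digital
payoffs realise the ratios `1/δ` and `ζ̃(c)` (`IsMarket.const_spec`, `IsMarket.digital_spec`), so
the bound is the optimal value.

If an optimal payoff exists and `1/δ < γ̃* < ∞`, all these inequalities are equalities for almost
every `t` (`IsMarket.of_bound_le_prefValue`): each layer is either null or a digital payoff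
`1_{Z ≥ c}` at a maximiser `c` of `ζ̃`. Without a maximiser all layers are null, which is absurd;
with a unique one the payoff is a multiple of `1_{Z ≥ c}`, and the budget fixes the multiple.
-/

namespace DualPayoff

/-! ### Quantile functions -/

section Quantile

variable (μ : Measure ℝ)

lemma nonempty_lt_cdf {z : ℝ} (hz : z < 1) : {r : ℝ | z < cdf μ r}.Nonempty :=
  ((tendsto_cdf_atTop μ).eventually (lt_mem_nhds hz)).exists

lemma bddBelow_lt_cdf {z : ℝ} (hz : 0 < z) : BddBelow {r : ℝ | z < cdf μ r} := by
  obtain ⟨b, hb⟩ := ((tendsto_cdf_atBot μ).eventually (gt_mem_nhds hz)).exists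
  exact ⟨b, fun r hr => le_of_lt ((monotone_cdf μ).reflect_lt (hb.trans hr))⟩

lemma quantileInner_le {z t : ℝ} (hz : 0 < z) (h : z < cdf μ t) : quantileInner μ z ≤ t :=
  csInf_le (bddBelow_lt_cdf μ hz) h

lemma cdf_le_of_lt_quantileInner {z t : ℝ} (hz : 0 < z) (h : t < quantileInner μ z) :
    cdf μ t ≤ z :=
  not_lt.1 fun h' => h.not_ge (quantileInner_le μ hz h')

lemma le_quantileInner {z t : ℝ} (hz : z < 1) (h : cdf μ t ≤ z) : t ≤ quantileInner μ z :=
  le_csInf (nonempty_lt_cdf μ hz) fun _ hr => ((monotone_cdf μ).reflect_lt (h.trans_lt hr)).le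

/-- Together with `le_quantile`: at every level, endpoints included, `t < F⁻¹(z)` and
`F(t) ≤ z, F(t) < 1` are equivalent except possibly for `t = F⁻¹(z)`. -/
lemma cdf_of_lt_quantile {z t : ℝ} (h : (t : EReal) < quantile μ z) :
    cdf μ t ≤ max z 0 ∧ cdf μ t < 1 := by
  unfold quantile at h
  split_ifs at h with h0 h1
  · have key : ∀ y ∈ Ioo (0 : ℝ) 1, cdf μ t ≤ y := fun y hy => by
      refine cdf_le_of_lt_quantileInner μ hy.1 ?_
      exact_mod_cast h.trans_le (iInf₂_le y hy)
    refine ⟨?_, (key (1 / 2) (by norm_num)).trans_lt (by norm_num)⟩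
    rw [max_eq_right h0]
    refine le_of_forall_gt_imp_ge_of_dense fun a ha => ?_
    exact (key (min a (1 / 2)) ⟨by positivity, by simp; norm_num⟩).trans (min_le_left _ _)
  · obtain ⟨y, hy⟩ := lt_iSup_iff.1 h
    obtain ⟨hy', hty⟩ := lt_iSup_iff.1 hy
    have := (cdf_le_of_lt_quantileInner μ hy'.1 (by exact_mod_cast hty)).trans_lt hy'.2
    exact ⟨(cdf_le_one μ t).trans (h1.trans (le_max_left _ _)), this⟩
  · push Not at h0 h1
    have := cdf_le_of_lt_quantileInner μ h0 (by exact_mod_cast h)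
    exact ⟨this.trans (le_max_left _ _), this.trans_lt h1⟩

lemma le_quantile {z t : ℝ} (h : cdf μ t ≤ max z 0) (h' : cdf μ t < 1) :
    (t : EReal) ≤ quantile μ z := by
  unfold quantile
  split_ifs with h0 h1
  · rw [max_eq_right h0] at h
    refine le_iInf₂ fun y hy => ?_
    exact_mod_cast le_quantileInner μ hy.2 (h.trans hy.1.le)
  · obtain ⟨y, hy, hy1⟩ := exists_between h'
    refine le_iSup₂_of_le y ⟨(cdf_nonneg μ t).trans_lt hy, hy1⟩ ?_
    exact_mod_cast le_quantileInner μ hy1 hy.le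
  · push Not at h0 h1
    rw [max_eq_left h0.le] at h
    exact_mod_cast le_quantileInner μ h1 h

lemma toReal_quantile {z : ℝ} (hz : z ∈ Ioo (0 : ℝ) 1) :
    (quantile μ z).toReal = quantileInner μ z := by
  simp [quantile, not_le.2 hz.1, not_le.2 hz.2]

/-- The supremum may be taken over the rationals, which gives measurability. -/
lemma quantile_eq_iSup (z : ℝ) :
    quantile μ z =
      ⨆ r : ℚ, if cdf μ r ≤ max z 0 ∧ cdf μ r < 1 then ((r : ℝ) : EReal) else ⊥ := by
  classical
  refine le_antisymm (le_of_forall_lt fun a ha => ?_) (iSup_le fun r => ?_)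
  · obtain ⟨q, hq1, hq2⟩ := EReal.lt_iff_exists_rat_btwn.1 ha
    refine hq1.trans_le (le_iSup_of_le q ?_)
    rw [if_pos (cdf_of_lt_quantile μ hq2)]
  · split_ifs with h
    · exact le_quantile μ h.1 h.2
    · exact bot_le

/-- An extended real number is the length of any set of positive reals that lies between `(0, e)`
and `(0, e]`. -/
lemma toENNReal_eq_volume {e : EReal} {S : Set ℝ} (h1 : ∀ t : ℝ, (t : EReal) < e → t ∈ S)
    (h2 : ∀ t ∈ S, (t : EReal) ≤ e) : e.toENNReal = volume (S ∩ Ioi 0) := by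
  induction e with
  | bot =>
    have : S = ∅ := eq_empty_of_forall_notMem fun t ht => by simpa using h2 t ht
    simp [this]
  | top =>
    have : S = univ := eq_univ_of_forall fun t => h1 t (EReal.coe_lt_top t)
    simp [this]
  | coe e =>
    rw [EReal.toENNReal_of_ne_top (EReal.coe_ne_top e), EReal.toReal_coe]
    apply le_antisymm
    · have : Ioo 0 e ⊆ S ∩ Ioi 0 := fun t ht => ⟨h1 t (by exact_mod_cast ht.2), ht.1⟩
      simpa using measure_mono (μ := volume) this
    · have : S ∩ Ioi 0 ⊆ Ioc 0 e := fun t ht => ⟨ht.2, by exact_mod_cast h2 t ht.1⟩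
      simpa using measure_mono (μ := volume) this

/-- Layer-cake form of the quantile function. -/
lemma toENNReal_quantile {z : ℝ} (hz : 0 ≤ z) :
    (quantile μ z).toENNReal =
      ∫⁻ t in Ioi (0 : ℝ), {t | cdf μ t < 1 ∧ cdf μ t ≤ z}.indicator 1 t := by
  have hm : MeasurableSet {t | cdf μ t < 1 ∧ cdf μ t ≤ z} :=
    (measurableSet_lt (monotone_cdf μ).measurable measurable_const).inter
      (measurableSet_le (monotone_cdf μ).measurable measurable_const)
  rw [lintegral_indicator_one hm, Measure.restrict_apply hm]
  refine toENNReal_eq_volume (fun t ht => ?_) fun t ht => ?_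
  · have := cdf_of_lt_quantile μ ht
    rw [max_eq_left hz] at this
    exact this.symm
  · exact le_quantile μ (by rw [max_eq_left hz]; exact ht.2) ht.1

/-- Joint measurability of the quantile functions of a Markov kernel. -/
lemma measurable_quantile_kernel {α : Type*} [MeasurableSpace α] (κ : Kernel α ℝ)
    [IsMarkovKernel κ] : Measurable fun p : α × ℝ => quantile (κ p.1) p.2 := by
  classical
  simp_rw [quantile_eq_iSup, cdf_eq_real]
  refine Measurable.iSup fun r => Measurable.ite ?_ measurable_const measurable_const
  have h : Measurable fun p : α × ℝ => (κ p.1).real (Iic (r : ℝ)) :=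
    ((κ.measurable_coe measurableSet_Iic).comp measurable_fst).ennreal_toReal
  exact (measurableSet_le h (by fun_prop)).inter (measurableSet_lt h measurable_const)

lemma measurable_cdf_kernel {α : Type*} [MeasurableSpace α] (κ : Kernel α ℝ)
    [IsMarkovKernel κ] : Measurable fun p : α × ℝ => cdf (κ p.1) p.2 := by
  simp_rw [cdf_eq_real]
  have h : MeasurableSet {q : (α × ℝ) × ℝ | q.2 ≤ q.1.2} :=
    measurableSet_le (by fun_prop) (by fun_prop)
  exact (Kernel.measurable_kernel_prodMk_left (κ := κ.comap Prod.fst measurable_fst)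
    h).ennreal_toReal

end Quantile

/-- The tail `m([c, 1])`, set to zero for `c ≥ 1`: this is the weight that a unit layer of a
payoff receives if the payoff stays below the layer with probability `c`. -/
noncomputable def tailWeight (m : Measure ℝ) (c : ℝ) : ℝ≥0∞ :=
  if c < 1 then m (Icc c 1) else 0

/-- Layer-cake form of the preference value. -/
lemma prefValue_eq {Ω : Type*} [MeasurableSpace Ω] (P : Measure Ω) (m : Measure ℝ)
    [IsProbabilityMeasure m] (X : Ω → ℝ) :
    prefValue P m X = ∫⁻ t in Ioi (0 : ℝ), tailWeight m (cdf (P.map X) t) := by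
  set F := cdf (P.map X)
  have hF : Measurable F := (monotone_cdf _).measurable
  have hms : MeasurableSet {p : ℝ × ℝ | F p.2 < 1 ∧ F p.2 ≤ p.1} :=
    (measurableSet_lt (hF.comp measurable_snd) measurable_const).inter
      (measurableSet_le (hF.comp measurable_snd) measurable_fst)
  calc prefValue P m X
      = ∫⁻ z in Icc (0 : ℝ) 1, (∫⁻ t in Ioi (0 : ℝ),
          {p : ℝ × ℝ | F p.2 < 1 ∧ F p.2 ≤ p.1}.indicator 1 (z, t)) ∂m := by
        refine setLIntegral_congr_fun (μ := m) measurableSet_Icc fun z hz => ?_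
        exact toENNReal_quantile _ hz.1
    _ = ∫⁻ t in Ioi (0 : ℝ), ∫⁻ z in Icc (0 : ℝ) 1,
          {p : ℝ × ℝ | F p.2 < 1 ∧ F p.2 ≤ p.1}.indicator 1 (z, t) ∂m :=
        lintegral_lintegral_swap (f := fun z t =>
          {p : ℝ × ℝ | F p.2 < 1 ∧ F p.2 ≤ p.1}.indicator 1 (z, t))
          (measurable_one.indicator hms).aemeasurable
    _ = _ := by
        refine lintegral_congr fun t => ?_
        have h : MeasurableSet {z | F t < 1 ∧ F t ≤ z} :=
          hms.preimage (measurable_id.prodMk measurable_const)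
        change ∫⁻ z in Icc (0 : ℝ) 1, {z | F t < 1 ∧ F t ≤ z}.indicator 1 z ∂m = _
        rw [lintegral_indicator_one h, Measure.restrict_apply h]
        unfold tailWeight
        split_ifs with h1
        · congr 1
          ext z
          simp only [mem_inter_iff, mem_ofPred_eq, mem_Icc]
          have : 0 ≤ F t := cdf_nonneg _ t
          grind
        · simp [h1]

/-! ### Probability integral transforms and the law of `(Z, F_A(A))` -/

lemma volume_Icc_inter_Iic (u : ℝ) :
    (volume.restrict (Icc (0 : ℝ) 1)) (Iic u) = ENNReal.ofReal (min 1 u) := by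
  have : Iic u ∩ Icc (0 : ℝ) 1 = Icc 0 (min 1 u) := by ext; simp; tauto
  rw [Measure.restrict_apply measurableSet_Iic, this]
  simp

instance : IsProbabilityMeasure (volume.restrict (Icc (0 : ℝ) 1)) :=
  ⟨by simp⟩

lemma measure_cdf_lt_le (μ : Measure ℝ) [IsProbabilityMeasure μ] (h : Continuous (cdf μ)) {u : ℝ}
    (hu : u ∈ Ioo (0 : ℝ) 1) :
    μ {a | cdf μ a < u} ≤ ENNReal.ofReal u ∧ ENNReal.ofReal u ≤ μ {a | cdf μ a ≤ u} := by
  obtain ⟨a, rfl⟩ : ∃ a, cdf μ a = u :=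
    mem_range_of_exists_le_of_exists_ge h
      ((((tendsto_cdf_atBot μ).eventually (gt_mem_nhds hu.1)).exists).imp fun _ => le_of_lt)
      ((((tendsto_cdf_atTop μ).eventually (lt_mem_nhds hu.2)).exists).imp fun _ => le_of_lt)
  rw [ofReal_cdf]
  exact ⟨measure_mono fun b hb => ((monotone_cdf μ).reflect_lt hb).le,
    measure_mono fun b hb => monotone_cdf μ hb⟩

/-- A continuous CDF transforms its law into the uniform law on `[0, 1]`. -/
lemma map_cdf_of_continuous (μ : Measure ℝ) [IsProbabilityMeasure μ] (h : Continuous (cdf μ)) :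
    μ.map (cdf μ) = volume.restrict (Icc (0 : ℝ) 1) := by
  have hm : Measurable (cdf μ) := h.measurable
  have : IsProbabilityMeasure (μ.map (cdf μ)) := Measure.isProbabilityMeasure_map hm.aemeasurable
  refine Measure.ext_of_Iic _ _ fun u => ?_
  rw [volume_Icc_inter_Iic, Measure.map_apply hm measurableSet_Iic]
  change μ {a | cdf μ a ≤ u} = _
  rcases lt_or_ge u 0 with h0 | h0
  · have : {a | cdf μ a ≤ u} = ∅ :=
      eq_empty_of_forall_notMem fun a ha => (h0.trans_le (cdf_nonneg μ a)).not_ge ha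
    rw [this, min_eq_right (by linarith), ENNReal.ofReal_of_nonpos h0.le, measure_empty]
  rcases le_or_gt 1 u with h1 | h1
  · have : {a | cdf μ a ≤ u} = univ := eq_univ_of_forall fun a => (cdf_le_one μ a).trans h1
    rw [this, min_eq_left h1, measure_univ, ENNReal.ofReal_one]
  rw [min_eq_right h1.le]
  apply le_antisymm
  · -- the event `F ≤ u` lies in `F < u'` for every `u' > u`
    have hlim : Tendsto ENNReal.ofReal (𝓝[>] u) (𝓝 (ENNReal.ofReal u)) :=
      (ENNReal.continuous_ofReal.tendsto u).mono_left nhdsWithin_le_nhds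
    refine ge_of_tendsto hlim ?_
    filter_upwards [Ioo_mem_nhdsGT h1] with v hv
    exact (measure_mono fun a ha => lt_of_le_of_lt ha hv.1).trans
      (measure_cdf_lt_le μ h ⟨h0.trans_lt hv.1, hv.2⟩).1
  · rcases h0.eq_or_lt with rfl | h0
    · simp
    · exact (measure_cdf_lt_le μ h ⟨h0, h1⟩).2

/-- The quantile function transforms the uniform law into the given law. -/
lemma map_quantile_uniform (ν : Measure ℝ) [IsProbabilityMeasure ν] :
    (volume.restrict (Icc (0 : ℝ) 1)).map (fun w => (quantile ν w).toReal) = ν := by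
  have hm : Measurable fun w => (quantile ν w).toReal :=
    ((measurable_quantile_kernel (Kernel.const Unit ν)).comp
      (measurable_const (a := ()).prodMk measurable_id)).ereal_toReal
  refine Measure.ext_of_Iic _ _ fun t => ?_
  have h01 : volume.restrict (Icc (0 : ℝ) 1) = volume.restrict (Ioo (0 : ℝ) 1) :=
    Measure.restrict_congr_set Ioo_ae_eq_Icc.symm
  rw [Measure.map_apply hm measurableSet_Iic, ← ofReal_cdf, h01,
    Measure.restrict_apply (hm measurableSet_Iic)]
  have h1 := cdf_le_one ν t
  apply le_antisymm
  · have : (fun w => (quantile ν w).toReal) ⁻¹' Iic t ∩ Ioo 0 1 ⊆ Ioc 0 (cdf ν t) := by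
      rintro w ⟨hw, hw'⟩
      refine ⟨hw'.1, ?_⟩
      rw [mem_preimage, toReal_quantile ν hw', mem_Iic] at hw
      -- `F` exceeds `w` to the right of the quantile, and `F` is right-continuous
      have hlim : Tendsto (cdf ν) (𝓝[>] t) (𝓝 (cdf ν t)) :=
        ((cdf ν).right_continuous t).tendsto.mono_left (nhdsWithin_mono _ Ioi_subset_Ici_self)
      refine ge_of_tendsto hlim (eventually_mem_nhdsWithin.mono fun s hs => ?_)
      exact not_lt.1 fun h => (hw.trans_lt hs).not_ge (le_quantileInner ν hw'.2 h.le)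
    simpa using measure_mono (μ := volume) this
  · have : Ioo 0 (cdf ν t) ⊆ (fun w => (quantile ν w).toReal) ⁻¹' Iic t ∩ Ioo 0 1 := by
      intro w hw
      have hw' : w ∈ Ioo (0 : ℝ) 1 := ⟨hw.1, hw.2.trans_le h1⟩
      refine ⟨?_, hw'⟩
      rw [mem_preimage, toReal_quantile ν hw', mem_Iic]
      exact quantileInner_le ν hw.1 hw.2
    simpa using measure_mono (μ := volume) this

lemma map_one_sub_uniform :
    (volume.restrict (Icc (0 : ℝ) 1)).map (fun w => 1 - w) = volume.restrict (Icc (0 : ℝ) 1) := by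
  have := (volume.measurePreserving_sub_left (1 : ℝ)).restrict_preimage
    (s := Icc (0 : ℝ) 1) measurableSet_Icc
  have h2 : (fun w : ℝ => 1 - w) ⁻¹' Icc 0 1 = Icc 0 1 := by
    ext w
    simp only [mem_preimage, mem_Icc]
    constructor <;> intro h <;> constructor <;> linarith [h.1, h.2]
  rw [h2] at this
  exact this.map_eq

instance (C : Copula) (v : ℝ) : IsProbabilityMeasure (C.condFst v) := by
  unfold Copula.condFst; infer_instance

variable {Ω : Type*} [MeasurableSpace Ω] {P : Measure Ω} [IsProbabilityMeasure P]
  {ρ A : Ω → ℝ} {C : Copula}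

/-- `Z` as a function of the values of `A` and `ρ`. -/
noncomputable def zFun (P : Measure Ω) [IsProbabilityMeasure P] (ρ A : Ω → ℝ) (C : Copula)
    (a r : ℝ) : ℝ :=
  (quantile (C.condFst (cdf (P.map A) a)) (1 - condCdf P ρ A r a)).toReal

lemma measurable_cdf (μ : Measure ℝ) : Measurable (cdf μ) := (monotone_cdf μ).measurable

lemma measurable_condCdf : Measurable fun p : ℝ × ℝ => condCdf P ρ A p.2 p.1 :=
  measurable_cdf_kernel (condDistrib ρ A P)

lemma measurable_zFun : Measurable fun p : ℝ × ℝ => zFun P ρ A C p.1 p.2 := by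
  have h := measurable_quantile_kernel (condDistrib (Prod.fst : ℝ × ℝ → ℝ) Prod.snd C.law)
  exact (h.comp (((measurable_cdf (P.map A)).comp measurable_fst).prodMk
    (measurable_const.sub measurable_condCdf))).ereal_toReal

lemma zVar_eq_zFun (ω : Ω) : zVar P ρ A C ω = zFun P ρ A C (A ω) (ρ ω) := by
  rw [zVar, zFun]

/-- The standing assumptions on the pricing kernel `ρ` and the benchmark `A`. -/
structure IsMarket (P : Measure Ω) [IsProbabilityMeasure P] (ρ A : Ω → ℝ) : Prop where
  measurable_kernel : Measurable ρ
  pos : ∀ᵐ ω ∂P, 0 < ρ ω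
  integrable : Integrable ρ P
  measurable_benchmark : Measurable A
  continuous_condCdf : ∀ᵐ a ∂(P.map A), Continuous fun r => condCdf P ρ A r a
  continuous_cdf : Continuous fun a => cdf (P.map A) a

lemma IsMarket.measurable_zVar (hM : IsMarket P ρ A) : Measurable (zVar P ρ A C) := by
  have h : Measurable fun ω => zFun P ρ A C (A ω) (ρ ω) :=
    Measurable.comp (g := fun p : ℝ × ℝ => zFun P ρ A C p.1 p.2) (f := fun ω => (A ω, ρ ω))
      measurable_zFun (hM.measurable_benchmark.prodMk hM.measurable_kernel)
  rwa [← funext zVar_eq_zFun] at h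

/-- Given `A = a`, the law of `Z` is the conditional law prescribed by the copula. -/
lemma map_zFun {a : ℝ} (h : Continuous fun r => condCdf P ρ A r a) :
    (condDistrib ρ A P a).map (zFun P ρ A C a) = C.condFst (cdf (P.map A) a) := by
  set ν := C.condFst (cdf (P.map A) a)
  have hq : Measurable fun w => (quantile ν w).toReal :=
    ((measurable_quantile_kernel (Kernel.const Unit ν)).comp
      (measurable_const (a := ()).prodMk measurable_id)).ereal_toReal
  rw [← map_quantile_uniform ν, ← map_one_sub_uniform, ← map_cdf_of_continuous _ h,
    Measure.map_map (by fun_prop) (measurable_cdf _), Measure.map_map hq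
      ((by fun_prop : Measurable fun w : ℝ => 1 - w).comp (measurable_cdf _))]
  rfl

/-- The pair `(Z, F_A(A))` is distributed according to the copula. -/
lemma IsMarket.measure_zVar_mem (hM : IsMarket P ρ A) {E B : Set ℝ} (hE : MeasurableSet E)
    (hB : MeasurableSet B) :
    P {ω | zVar P ρ A C ω ∈ E ∧ cdf (P.map A) (A ω) ∈ B} = C.law (E ×ˢ B) := by
  have : IsProbabilityMeasure (P.map A) :=
    Measure.isProbabilityMeasure_map hM.measurable_benchmark.aemeasurable
  have hF := measurable_cdf (P.map A)
  have hS : MeasurableSet {p : ℝ × ℝ | zFun P ρ A C p.1 p.2 ∈ E ∧ cdf (P.map A) p.1 ∈ B} :=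
    (measurable_zFun hE).inter ((hF.comp measurable_fst) hB)
  have hunif : (P.map A).map (cdf (P.map A)) = C.law.map Prod.snd := by
    rw [C.map_snd, map_cdf_of_continuous _ hM.continuous_cdf]
  have hk : Measurable fun u => C.condFst u E := Kernel.measurable_coe _ hE
  calc P {ω | zVar P ρ A C ω ∈ E ∧ cdf (P.map A) (A ω) ∈ B}
      = (P.map fun ω => (A ω, ρ ω))
          {p : ℝ × ℝ | zFun P ρ A C p.1 p.2 ∈ E ∧ cdf (P.map A) p.1 ∈ B} := by
        simp_rw [Measure.map_apply (hM.measurable_benchmark.prodMk hM.measurable_kernel) hS,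
          zVar_eq_zFun, preimage_ofPred_eq]
    _ = ∫⁻ a, condDistrib ρ A P a
          {r | zFun P ρ A C a r ∈ E ∧ cdf (P.map A) a ∈ B} ∂(P.map A) := by
        rw [← compProd_map_condDistrib hM.measurable_kernel.aemeasurable, Measure.compProd_apply hS]
        simp_rw [preimage_ofPred_eq]
    _ = ∫⁻ a, B.indicator (fun u => C.condFst u E) (cdf (P.map A) a) ∂(P.map A) := by
        refine lintegral_congr_ae (hM.continuous_condCdf.mono fun a ha => ?_)
        by_cases hb : cdf (P.map A) a ∈ B
        · have hz : Measurable (zFun P ρ A C a) :=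
            Measurable.comp (g := fun p : ℝ × ℝ => zFun P ρ A C p.1 p.2) (f := fun r => (a, r))
              measurable_zFun measurable_prodMk_left
          simp only [hb, and_true, indicator_of_mem, ← map_zFun ha]
          rw [Measure.map_apply hz hE]; rfl
        · simp [hb]
    _ = ∫⁻ u in B, C.condFst u E ∂(C.law.map Prod.snd) := by
        rw [← hunif, ← lintegral_indicator hB, lintegral_map (hk.indicator hB) hF]
    _ = (C.law.map fun p : ℝ × ℝ => (p.2, p.1)) (B ×ˢ E) := by
        rw [← compProd_map_condDistrib (X := (Prod.snd : ℝ × ℝ → ℝ)) (Y := Prod.fst)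
          measurable_fst.aemeasurable, Measure.compProd_apply_prod hB hE]
        rfl
    _ = C.law (E ×ˢ B) := by
        rw [Measure.map_apply (by fun_prop) (hB.prod hE)]
        congr 1
        ext p
        simp [and_comm]

lemma IsMarket.map_zVar (hM : IsMarket P ρ A) :
    P.map (zVar P ρ A C) = volume.restrict (Icc (0 : ℝ) 1) := by
  ext E hE
  rw [Measure.map_apply hM.measurable_zVar hE, ← C.map_fst,
    Measure.map_apply measurable_fst hE]
  have := hM.measure_zVar_mem (C := C) hE MeasurableSet.univ
  simp only [mem_univ, and_true, prod_univ] at this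
  exact this

/-- The pair `(Z, A)` has copula `C`, with `Z` uniform. -/
lemma IsMarket.measure_zVar_le_inter (hM : IsMarket P ρ A) (z a : ℝ) :
    P.real {ω | zVar P ρ A C ω ≤ z ∧ A ω ≤ a} = C.fn z (cdf (P.map A) a) := by
  have : IsProbabilityMeasure (P.map A) :=
    Measure.isProbabilityMeasure_map hM.measurable_benchmark.aemeasurable
  have h := hM.measure_zVar_mem (C := C) (measurableSet_Iic (a := z))
    (measurableSet_Iic (a := cdf (P.map A) a))
  rw [Copula.fn, measureReal_def, measureReal_def, ← h]
  congr 1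
  -- the events `A ≤ a` and `F_A(A) ≤ F_A(a)` are nested and have the same probability
  have hF := measurable_cdf (P.map A)
  have hae : {b | b ≤ a} =ᵐ[P.map A] {b | cdf (P.map A) b ≤ cdf (P.map A) a} := by
    refine ae_eq_of_subset_of_measure_ge (fun b hb => monotone_cdf _ hb) ?_
      measurableSet_Iic.nullMeasurableSet (measure_ne_top _ _)
    change (P.map A) (cdf (P.map A) ⁻¹' Iic _) ≤ P.map A (Iic a)
    rw [← Measure.map_apply hF measurableSet_Iic, map_cdf_of_continuous _ hM.continuous_cdf,
      volume_Icc_inter_Iic, min_eq_right (cdf_le_one _ _), ofReal_cdf]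
  have hae' := ae_of_ae_map hM.measurable_benchmark.aemeasurable hae.mem_iff
  refine measure_congr (eventuallyEq_set.2 ?_)
  filter_upwards [hae'] with ω hω
  simp only [mem_Iic] at hω ⊢
  rw [hω]

/-! ### Cheapest events with a prescribed dependence on the benchmark -/

/-- A conditional Neyman–Pearson lemma. Among the events `S` with the same conditional
probabilities given `A` as `D`, the event `D = {R ≤ h(A)}` minimises `E[R 1_S]`, and it is the only
minimiser up to null sets. -/
lemma lintegral_le_of_threshold {R : Ω → ℝ≥0∞} (hR : Measurable R) {A : Ω → ℝ} (hA : Measurable A)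
    {h : ℝ → ℝ≥0∞} (hh : Measurable h) {D S : Set Ω} (hD : MeasurableSet D) (hS : MeasurableSet S)
    (hin : ∀ᵐ ω ∂P, ω ∈ D → R ω ≤ h (A ω)) (hout : ∀ᵐ ω ∂P, ω ∉ D → h (A ω) < R ω)
    (hSD : ∀ B, MeasurableSet B → P (A ⁻¹' B ∩ S) = P (A ⁻¹' B ∩ D)) :
    ∫⁻ ω in D, R ω ∂P ≤ ∫⁻ ω in S, R ω ∂P ∧
      (∫⁻ ω in S, R ω ∂P ≤ ∫⁻ ω in D, R ω ∂P → ∫⁻ ω in D, R ω ∂P ≠ ∞ → S =ᵐ[P] D) := by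
  have hlaw : (P.restrict (S \ D)).map A = (P.restrict (D \ S)).map A := by
    ext B hB
    rw [Measure.map_apply hA hB, Measure.map_apply hA hB, Measure.restrict_apply (hA hB),
      Measure.restrict_apply (hA hB)]
    have h1 := measure_inter_add_sdiff (μ := P) (A ⁻¹' B ∩ S) hD
    have h2 := measure_inter_add_sdiff (μ := P) (A ⁻¹' B ∩ D) hS
    rw [hSD B hB, ← h2, inter_assoc, inter_assoc, inter_comm D S] at h1
    rw [← inter_sdiff_assoc, ← inter_sdiff_assoc]
    exact (ENNReal.add_right_inj (measure_ne_top _ _)).1 h1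
  have hDS : ∫⁻ ω in D \ S, R ω ∂P ≤ ∫⁻ ω in S \ D, h (A ω) ∂P := by
    calc ∫⁻ ω in D \ S, R ω ∂P ≤ ∫⁻ ω in D \ S, h (A ω) ∂P :=
          lintegral_mono_ae ((ae_restrict_iff' (hD.diff hS)).2
            (hin.mono fun ω hω hω' => hω hω'.1))
      _ = ∫⁻ ω in S \ D, h (A ω) ∂P := by
          rw [← lintegral_map hh hA, ← hlaw, lintegral_map hh hA]
  have hlt : ∀ᵐ ω ∂(P.restrict (S \ D)), h (A ω) < R ω :=
    (ae_restrict_iff' (hS.diff hD)).2 (hout.mono fun ω hω hω' => hω hω'.2)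
  have hle : ∫⁻ ω in S \ D, h (A ω) ∂P ≤ ∫⁻ ω in S \ D, R ω ∂P :=
    lintegral_mono_ae (hlt.mono fun ω hω => hω.le)
  have eD := lintegral_inter_add_sdiff (μ := P) R D hS
  have eS := lintegral_inter_add_sdiff (μ := P) R S hD
  rw [inter_comm] at eD
  refine ⟨?_, fun hSD' hfin => ?_⟩
  · rw [← eD, ← eS]
    exact add_le_add le_rfl (hDS.trans hle)
  · have hcap : ∫⁻ ω in S ∩ D, R ω ∂P ≠ ∞ := ne_top_of_le_ne_top hfin (eD ▸ le_self_add)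
    have hDfin : ∫⁻ ω in D \ S, R ω ∂P ≠ ∞ := ne_top_of_le_ne_top hfin (eD ▸ le_add_self)
    have hcmp : ∫⁻ ω in S \ D, R ω ∂P ≤ ∫⁻ ω in D \ S, R ω ∂P := by
      rw [← eD, ← eS] at hSD'
      exact (ENNReal.add_le_add_iff_left hcap).1 hSD'
    have hnull : P (S \ D) = 0 := by
      by_contra hne
      have hne' : P.restrict (S \ D) ≠ 0 := by simpa using hne
      have := lintegral_strict_mono hne' hR.aemeasurable
        (ne_top_of_le_ne_top hDfin (hle.trans hcmp)) hlt
      exact (this.trans_le (hcmp.trans hDS)).false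
    have hnull' : P (D \ S) = 0 := by
      have := congrArg (fun ν : Measure ℝ => ν univ) hlaw
      simp only [Measure.map_apply hA MeasurableSet.univ, preimage_univ,
        Measure.restrict_apply_univ] at this
      rw [← this, hnull]
    exact (ae_le_set.2 hnull).antisymm (ae_le_set.2 hnull')

lemma le_quantileInner_iff (ν : Measure ℝ) [IsProbabilityMeasure ν] {w c : ℝ}
    (hw : w ∈ Ioo (0 : ℝ) 1) : c ≤ quantileInner ν w ↔ ν.real (Iio c) ≤ w := by
  have hreal : ν.real (Iio c) = Function.leftLim (cdf ν) c := by
    conv_lhs => rw [← measure_cdf ν]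
    rw [measureReal_def, StieltjesFunction.measure_Iio _ (tendsto_cdf_atBot ν), sub_zero,
      ENNReal.toReal_ofReal]
    exact (cdf_nonneg ν (c - 1)).trans ((monotone_cdf ν).le_leftLim (by linarith))
  constructor
  · intro h
    rw [hreal]
    refine le_of_tendsto ((monotone_cdf ν).tendsto_leftLim c)
      (eventually_mem_nhdsWithin.mono fun r hr => ?_)
    exact cdf_le_of_lt_quantileInner ν hw.1 (lt_of_lt_of_le hr h)
  · intro h
    refine le_of_forall_lt_imp_le_of_dense fun r hr => le_quantileInner ν hw.2 ?_
    rw [cdf_eq_real]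
    exact (measureReal_mono (Iic_subset_Iio.2 hr)).trans h

lemma IsMarket.ae_condCdf_mem (hM : IsMarket P ρ A) :
    ∀ᵐ ω ∂P, condCdf P ρ A (ρ ω) (A ω) ∈ Ioo (0 : ℝ) 1 := by
  have hm : Measurable fun ω => (A ω, ρ ω) := hM.measurable_benchmark.prodMk hM.measurable_kernel
  have hset : MeasurableSet {p : ℝ × ℝ | condCdf P ρ A p.2 p.1 ∈ Ioo (0 : ℝ) 1} :=
    measurable_condCdf measurableSet_Ioo
  refine ae_of_ae_map (p := fun p : ℝ × ℝ => condCdf P ρ A p.2 p.1 ∈ Ioo (0 : ℝ) 1)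
    hm.aemeasurable ?_
  rw [← compProd_map_condDistrib hM.measurable_kernel.aemeasurable, Measure.ae_compProd_iff hset]
  filter_upwards [hM.continuous_condCdf] with a ha
  refine ae_of_ae_map (p := fun u : ℝ => u ∈ Ioo (0 : ℝ) 1)
    (measurable_cdf (condDistrib ρ A P a)).aemeasurable ?_
  rw [map_cdf_of_continuous _ ha, Measure.restrict_congr_set Ioo_ae_eq_Icc.symm]
  exact ae_restrict_mem measurableSet_Ioo

/-- Up to null sets, `{Z ≥ c}` is the event that `ρ` is at most a function of the benchmark. -/
lemma IsMarket.exists_threshold (hM : IsMarket P ρ A) (C : Copula) (c : ℝ) :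
    ∃ h : ℝ → ℝ≥0∞, Measurable h ∧
      (∀ᵐ ω ∂P, ω ∈ {ω | c ≤ zVar P ρ A C ω} → ENNReal.ofReal (ρ ω) ≤ h (A ω)) ∧
      (∀ᵐ ω ∂P, ω ∉ {ω | c ≤ zVar P ρ A C ω} → h (A ω) < ENNReal.ofReal (ρ ω)) := by
  classical
  set w : ℝ → ℝ := fun a => (C.condFst (cdf (P.map A) a)).real (Iio c)
  have hw : Measurable w := by
    have : Measurable fun v => C.condFst v (Iio c) := Kernel.measurable_coe _ measurableSet_Iio
    exact (this.comp (measurable_cdf (P.map A))).ennreal_toReal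
  -- `h` is the largest conditional quantile of `ρ` at the level `1 - w`
  set h : ℝ → ℝ≥0∞ := fun a =>
    ⨆ s : ℚ, if condCdf P ρ A s a ≤ 1 - w a then ENNReal.ofReal s else 0
  have hiff : ∀ᵐ ω ∂P, c ≤ zVar P ρ A C ω ↔ condCdf P ρ A (ρ ω) (A ω) ≤ 1 - w (A ω) := by
    filter_upwards [hM.ae_condCdf_mem] with ω hω
    have hω' : 1 - condCdf P ρ A (ρ ω) (A ω) ∈ Ioo (0 : ℝ) 1 :=
      ⟨by linarith [hω.2], by linarith [hω.1]⟩
    rw [zVar, toReal_quantile _ hω', le_quantileInner_iff _ hω']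
    exact le_sub_comm
  refine ⟨h, ?_, ?_, ?_⟩
  · refine Measurable.iSup fun s => Measurable.ite ?_ measurable_const measurable_const
    have hc : Measurable fun a => condCdf P ρ A s a :=
      Measurable.comp (g := fun p : ℝ × ℝ => condCdf P ρ A p.2 p.1) (f := fun a => (a, (s : ℝ)))
        measurable_condCdf measurable_prodMk_right
    exact measurableSet_le hc (measurable_const.sub hw)
  · filter_upwards [hiff] with ω hω hZ
    rw [hω] at hZ
    refine le_of_forall_lt fun b hb => ?_
    lift b to NNReal using hb.ne_top
    rw [ENNReal.lt_ofReal_iff_toReal_lt ENNReal.coe_ne_top] at hb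
    obtain ⟨s, hs1, hs2⟩ := exists_rat_btwn hb
    refine lt_of_lt_of_le ?_ (le_iSup _ s)
    have hs : condCdf P ρ A s (A ω) ≤ 1 - w (A ω) := (monotone_cdf _ hs2.le).trans hZ
    rw [if_pos hs]
    exact (ENNReal.lt_ofReal_iff_toReal_lt ENNReal.coe_ne_top).2 hs1
  · filter_upwards [hiff, hM.pos, ae_of_ae_map hM.measurable_benchmark.aemeasurable
      hM.continuous_condCdf] with ω hω hpos hcont hZ
    rw [hω, not_le] at hZ
    -- by continuity the conditional CDF exceeds the level already at some `r < ρ`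
    obtain ⟨r, hr, hr'⟩ : ∃ r < ρ ω, 1 - w (A ω) < condCdf P ρ A r (A ω) := by
      have := (hcont.tendsto (ρ ω)).eventually (lt_mem_nhds hZ)
      obtain ⟨r, h1, h2⟩ := ((this.filter_mono nhdsWithin_le_nhds).and
        (eventually_mem_nhdsWithin (s := Iio (ρ ω)))).exists
      exact ⟨r, h2, h1⟩
    refine lt_of_le_of_lt (b := ENNReal.ofReal r) (iSup_le fun s => ?_)
      ((ENNReal.ofReal_lt_ofReal_iff hpos).2 hr)
    split_ifs with hs
    · exact ENNReal.ofReal_le_ofReal ((monotone_cdf _).reflect_lt (hs.trans_lt hr')).le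
    · exact zero_le

variable {m : Measure ℝ}

/-! ### The price of the events `{Z ≥ c}` -/

/-- The price `E[ρ 1_{Z ≥ c}]` of a unit digital payoff, in `[0, ∞]`. -/
noncomputable def tailPrice (P : Measure Ω) [IsProbabilityMeasure P] (ρ A : Ω → ℝ) (C : Copula)
    (c : ℝ) : ℝ≥0∞ :=
  ∫⁻ ω in {ω | c ≤ zVar P ρ A C ω}, ENNReal.ofReal (ρ ω) ∂P

lemma antitone_tailPrice : Antitone (tailPrice P ρ A C) := fun _ _ hcd =>
  lintegral_mono_set fun _ hω => le_trans hcd hω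

lemma IsMarket.measurableSet_le_zVar (hM : IsMarket P ρ A) (c : ℝ) :
    MeasurableSet {ω | c ≤ zVar P ρ A C ω} :=
  measurableSet_le measurable_const hM.measurable_zVar

lemma IsMarket.lintegral_ofReal (hM : IsMarket P ρ A) (D : Set Ω) :
    ∫⁻ ω in D, ENNReal.ofReal (ρ ω) ∂P = ENNReal.ofReal (∫ ω in D, ρ ω ∂P) :=
  (ofReal_integral_eq_lintegral_ofReal hM.integrable.restrict
    (ae_restrict_of_ae (hM.pos.mono fun _ h => h.le))).symm

lemma IsMarket.tailPrice_ne_top (hM : IsMarket P ρ A) (c : ℝ) : tailPrice P ρ A C c ≠ ∞ := by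
  rw [tailPrice, hM.lintegral_ofReal]
  exact ENNReal.ofReal_ne_top

lemma IsMarket.measure_zVar_le (hM : IsMarket P ρ A) (u : ℝ) :
    P {ω | zVar P ρ A C ω ≤ u} = ENNReal.ofReal (min 1 u) := by
  rw [← volume_Icc_inter_Iic, ← hM.map_zVar (C := C),
    Measure.map_apply hM.measurable_zVar measurableSet_Iic]
  rfl

lemma IsMarket.ae_zVar_ne (hM : IsMarket P ρ A) (c : ℝ) : ∀ᵐ ω ∂P, zVar P ρ A C ω ≠ c := by
  refine ae_of_ae_map (p := fun z => z ≠ c) hM.measurable_zVar.aemeasurable ?_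
  rw [hM.map_zVar]
  exact ae_restrict_of_ae (Measure.ae_ne volume c)

lemma IsMarket.ae_zVar_mem (hM : IsMarket P ρ A) :
    ∀ᵐ ω ∂P, zVar P ρ A C ω ∈ Icc (0 : ℝ) 1 := by
  refine ae_of_ae_map (p := fun z => z ∈ Icc (0 : ℝ) 1) hM.measurable_zVar.aemeasurable ?_
  rw [hM.map_zVar]
  exact ae_restrict_mem measurableSet_Icc

lemma IsMarket.measure_le_zVar_pos (hM : IsMarket P ρ A) {c : ℝ} (hc : c < 1) :
    P {ω | c ≤ zVar P ρ A C ω} ≠ 0 := fun h0 => by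
  have hle : ∀ᵐ ω ∂P, zVar P ρ A C ω ≤ c := by
    filter_upwards [measure_eq_zero_iff_ae_notMem.1 h0] with ω hω
    exact (not_le.1 hω).le
  have h1 : P {ω | zVar P ρ A C ω ≤ c} = 1 := by
    rw [measure_congr (eventuallyEq_univ.2 hle), measure_univ]
  rw [hM.measure_zVar_le, min_eq_right hc.le] at h1
  exact absurd h1 (ENNReal.ofReal_lt_one.2 hc).ne

lemma IsMarket.tailPrice_ne_zero (hM : IsMarket P ρ A) {c : ℝ} (hc : c < 1) :
    tailPrice P ρ A C c ≠ 0 := by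
  have hμ : P.restrict {ω | c ≤ zVar P ρ A C ω} ≠ 0 := by
    simpa using hM.measure_le_zVar_pos hc
  have := lintegral_strict_mono (f := fun _ => 0) hμ
    hM.measurable_kernel.ennreal_ofReal.aemeasurable (by simp)
    (ae_restrict_of_ae (hM.pos.mono fun ω h => ENNReal.ofReal_pos.2 h))
  simpa [tailPrice] using this.ne'

lemma IsMarket.integral_pos (hM : IsMarket P ρ A) : 0 < ∫ ω, ρ ω ∂P := by
  refine (integral_pos_iff_support_of_nonneg_ae (hM.pos.mono fun _ h => h.le) hM.integrable).2 ?_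
  have hsupp : Function.support ρ ∈ ae P := hM.pos.mono fun _ h => h.ne'
  simp [measure_congr (eventuallyEq_univ.2 hsupp)]

/-- The denominator of `ζ̃(c)` is the price of the event `{Z ≥ c}`. -/
lemma IsMarket.integral_phi (hM : IsMarket P ρ A) {c : ℝ} (hc : c ∈ Ioo (0 : ℝ) 1) :
    ∫ z in c..1, phi P ρ A C z = ∫ ω in {ω | c ≤ zVar P ρ A C ω}, ρ ω ∂P := by
  have hZ := hM.measurable_zVar (C := C)
  have hcond : P[ρ | MeasurableSpace.comap (zVar P ρ A C) inferInstance]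
      =ᵐ[P] fun ω => phi P ρ A C (zVar P ρ A C ω) :=
    condExp_ae_eq_integral_condDistrib' hZ hM.integrable
  have hint : Integrable ρ P := hM.integrable
  have hφ : AEStronglyMeasurable (phi P ρ A C) (P.map (zVar P ρ A C)) := by
    have : StronglyMeasurable fun p : ℝ × ℝ => p.2 := measurable_snd.stronglyMeasurable
    exact (this.integral_condDistrib (Y := ρ) (X := zVar P ρ A C)
      (μ := P)).aestronglyMeasurable
  calc ∫ z in c..1, phi P ρ A C z
      = ∫ z in Ici c, phi P ρ A C z ∂(P.map (zVar P ρ A C)) := by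
        rw [hM.map_zVar, Measure.restrict_restrict measurableSet_Ici,
          intervalIntegral.integral_of_le hc.2.le, ← integral_Icc_eq_integral_Ioc]
        congr 2
        ext z
        simp only [mem_Icc, mem_inter_iff, mem_Ici]
        exact ⟨fun h => ⟨h.1, hc.1.le.trans h.1, h.2⟩, fun h => ⟨h.1, h.2.2⟩⟩
    _ = ∫ ω in {ω | c ≤ zVar P ρ A C ω}, phi P ρ A C (zVar P ρ A C ω) ∂P :=
        setIntegral_map measurableSet_Ici hφ hZ.aemeasurable
    _ = ∫ ω in {ω | c ≤ zVar P ρ A C ω},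
          (P[ρ | MeasurableSpace.comap (zVar P ρ A C) inferInstance]) ω ∂P :=
        setIntegral_congr_ae (hM.measurableSet_le_zVar c) (hcond.mono fun ω h _ => h.symm)
    _ = _ := setIntegral_condExp hZ.comap_le hint ⟨Ici c, measurableSet_Ici, rfl⟩

lemma IsMarket.ofReal_zeta [IsProbabilityMeasure m] (hM : IsMarket P ρ A) {c : ℝ}
    (hc : c ∈ Ioo (0 : ℝ) 1) :
    ENNReal.ofReal (zeta P m ρ A C c) = m (Icc c 1) / tailPrice P ρ A C c := by
  have h0 := hM.tailPrice_ne_zero (C := C) hc.2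
  rw [tailPrice, hM.lintegral_ofReal, ← hM.integral_phi hc] at h0 ⊢
  rw [zeta, ENNReal.ofReal_div_of_pos (by simpa using h0), ofReal_measureReal]

/-! ### The upper bound -/

/-- The supremum of the preference value per unit of wealth of a constant or digital payoff. -/
noncomputable def bestRatio (P : Measure Ω) [IsProbabilityMeasure P] (m : Measure ℝ)
    (ρ A : Ω → ℝ) (C : Copula) : ℝ≥0∞ :=
  max (ENNReal.ofReal (1 / ∫ ω, ρ ω ∂P)) (gammaStar P m ρ A C)

lemma ofReal_zeta_le_gammaStar {c : ℝ} (hc : c ∈ Ioo (0 : ℝ) 1) :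
    ENNReal.ofReal (zeta P m ρ A C c) ≤ gammaStar P m ρ A C :=
  le_iSup₂ (f := fun c (_ : c ∈ Ioo (0 : ℝ) 1) => ENNReal.ofReal (zeta P m ρ A C c)) c hc

lemma IsMarket.tailPrice_zero (hM : IsMarket P ρ A) :
    tailPrice P ρ A C 0 = ENNReal.ofReal (∫ ω, ρ ω ∂P) := by
  rw [← setIntegral_univ, ← hM.lintegral_ofReal, tailPrice]
  refine setLIntegral_congr (eventuallyEq_univ.2 ?_)
  exact hM.ae_zVar_mem.mono fun ω h => h.1

lemma IsMarket.tailWeight_eq_zeta_mul [IsProbabilityMeasure m] (hM : IsMarket P ρ A) {c : ℝ}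
    (hc : c ∈ Ioo (0 : ℝ) 1) :
    tailWeight m c = ENNReal.ofReal (zeta P m ρ A C c) * tailPrice P ρ A C c := by
  rw [hM.ofReal_zeta hc, ENNReal.div_mul_cancel (hM.tailPrice_ne_zero hc.2) (hM.tailPrice_ne_top c),
    tailWeight, if_pos hc.2]

lemma IsMarket.tailWeight_zero_eq (hM : IsMarket P ρ A) (hm : m (Icc (0 : ℝ) 1) = 1) :
    tailWeight m 0 = ENNReal.ofReal (1 / ∫ ω, ρ ω ∂P) * tailPrice P ρ A C 0 := by
  rw [hM.tailPrice_zero, ← ENNReal.ofReal_mul (one_div_nonneg.2 hM.integral_pos.le),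
    one_div_mul_cancel hM.integral_pos.ne', tailWeight, if_pos one_pos, hm, ENNReal.ofReal_one]

lemma IsMarket.tailWeight_le [IsProbabilityMeasure m] (hM : IsMarket P ρ A)
    (hm : m (Icc (0 : ℝ) 1) = 1) {c : ℝ} (hc : 0 ≤ c) :
    tailWeight m c ≤ bestRatio P m ρ A C * tailPrice P ρ A C c := by
  rcases le_or_gt 1 c with h1 | h1
  · rw [tailWeight, if_neg h1.not_gt]
    exact zero_le
  rcases hc.eq_or_lt with rfl | h0
  · rw [hM.tailWeight_zero_eq (C := C) hm]
    exact mul_le_mul_left (le_max_left _ _) _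
  · rw [hM.tailWeight_eq_zeta_mul (C := C) ⟨h0, h1⟩]
    exact mul_le_mul_left ((ofReal_zeta_le_gammaStar ⟨h0, h1⟩).trans (le_max_right _ _)) _

/-- The events `{X > t}` and `{Z ≥ F_X(t)}` have the same conditional probability given `A`. -/
lemma HasCopula.measure_inter {X : Ω → ℝ} (hM : IsMarket P ρ A) (hX : Measurable X)
    (hC : HasCopula P C X A) (t : ℝ) {B : Set ℝ} (hB : MeasurableSet B) :
    P (A ⁻¹' B ∩ {ω | t < X ω}) =
      P (A ⁻¹' B ∩ {ω | cdf (P.map X) t ≤ zVar P ρ A C ω}) := by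
  have hA := hM.measurable_benchmark
  have hZ := hM.measurable_zVar (C := C)
  set u := cdf (P.map X) t
  have hle : (P.restrict {ω | X ω ≤ t}).map A = (P.restrict {ω | zVar P ρ A C ω ≤ u}).map A := by
    refine Measure.ext_of_Iic _ _ fun a => ?_
    rw [Measure.map_apply hA measurableSet_Iic, Measure.map_apply hA measurableSet_Iic,
      Measure.restrict_apply (hA measurableSet_Iic), Measure.restrict_apply (hA measurableSet_Iic),
      inter_comm, inter_comm _ {ω | zVar P ρ A C ω ≤ u}]
    have := (hC t a).trans (hM.measure_zVar_le_inter (C := C) u a).symm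
    exact (measureReal_eq_measureReal_iff).1 this
  have h1 := congrArg (fun ν : Measure ℝ => ν B) hle
  simp only [Measure.map_apply hA hB, Measure.restrict_apply (hA hB)] at h1
  have hmX : MeasurableSet {ω | X ω ≤ t} := measurableSet_le hX measurable_const
  have hmZ : MeasurableSet {ω | zVar P ρ A C ω ≤ u} := measurableSet_le hZ measurable_const
  have e1 := measure_inter_add_sdiff (μ := P) (A ⁻¹' B) hmX
  have e2 := measure_inter_add_sdiff (μ := P) (A ⁻¹' B) hmZ
  rw [h1, ← e2] at e1
  have e3 := (ENNReal.add_right_inj (measure_ne_top _ _)).1 e1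
  have c1 : A ⁻¹' B ∩ {ω | t < X ω} = A ⁻¹' B \ {ω | X ω ≤ t} := by ext ω; simp
  rw [c1, e3]
  refine measure_congr (eventuallyEq_set.2 ?_)
  filter_upwards [hM.ae_zVar_ne (C := C) u] with ω hω
  simp only [Set.mem_sdiff, mem_inter_iff, mem_ofPred_eq, not_le]
  exact and_congr_right fun _ => ⟨le_of_lt, fun h => lt_of_le_of_ne h hω.symm⟩

/-- The layer of a payoff above `t` is at least as expensive as the digital payoff that has the
same probability and the same dependence on the benchmark. -/
lemma HasCopula.tailPrice_le {X : Ω → ℝ} (hM : IsMarket P ρ A) (hX : Measurable X)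
    (hC : HasCopula P C X A) (t : ℝ) :
    tailPrice P ρ A C (cdf (P.map X) t) ≤ ∫⁻ ω in {ω | t < X ω}, ENNReal.ofReal (ρ ω) ∂P ∧
      (∫⁻ ω in {ω | t < X ω}, ENNReal.ofReal (ρ ω) ∂P ≤ tailPrice P ρ A C (cdf (P.map X) t) →
        {ω | t < X ω} =ᵐ[P] {ω | cdf (P.map X) t ≤ zVar P ρ A C ω}) := by
  obtain ⟨h, hh, hin, hout⟩ := hM.exists_threshold C (cdf (P.map X) t)
  have key := lintegral_le_of_threshold hM.measurable_kernel.ennreal_ofReal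
    hM.measurable_benchmark hh (hM.measurableSet_le_zVar _) (measurableSet_lt measurable_const hX)
    hin hout fun B hB => hC.measure_inter hM hX t hB
  exact ⟨key.1, fun h => key.2 h (hM.tailPrice_ne_top _)⟩

/-- Layer-cake form of the price of a payoff. -/
lemma IsMarket.lintegral_kernel_mul (hM : IsMarket P ρ A) {X : Ω → ℝ} (hX : Measurable X)
    (h0 : ∀ᵐ ω ∂P, 0 ≤ X ω) :
    ∫⁻ ω, ENNReal.ofReal (ρ ω) * ENNReal.ofReal (X ω) ∂P =
      ∫⁻ t in Ioi (0 : ℝ), ∫⁻ ω in {ω | t < X ω}, ENNReal.ofReal (ρ ω) ∂P := by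
  have hR := hM.measurable_kernel.ennreal_ofReal
  have h := lintegral_withDensity_eq_lintegral_mul P hR hX.ennreal_ofReal
  simp only [Pi.mul_apply] at h
  rw [← h, lintegral_eq_lintegral_meas_lt _
    ((withDensity_absolutelyContinuous P _).ae_le h0) hX.aemeasurable]
  exact lintegral_congr fun t => withDensity_apply _ (measurableSet_lt measurable_const hX)

lemma IsMarket.lintegral_price (hM : IsMarket P ρ A) {x : ℝ} {X : Ω → ℝ}
    (hX : Feasible P ρ A C x X) :
    ∫⁻ ω, ENNReal.ofReal (ρ ω) * ENNReal.ofReal (X ω) ∂P =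
      ENNReal.ofReal (∫ ω, ρ ω * X ω ∂P) := by
  rw [ofReal_integral_eq_lintegral_ofReal hX.integrable]
  · refine lintegral_congr_ae (hM.pos.mono fun ω h => ?_)
    exact (ENNReal.ofReal_mul h.le).symm
  · filter_upwards [hM.pos, hX.nonneg] with ω h1 h2 using mul_nonneg h1.le h2

lemma measurable_tailPrice_cdf (μ : Measure ℝ) :
    Measurable fun t => tailPrice P ρ A C (cdf μ t) :=
  antitone_tailPrice.measurable.comp (measurable_cdf μ)

lemma IsMarket.lintegral_tailPrice_le (hM : IsMarket P ρ A) {x : ℝ} {X : Ω → ℝ}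
    (hX : Feasible P ρ A C x X) :
    ∫⁻ t in Ioi (0 : ℝ), tailPrice P ρ A C (cdf (P.map X) t) ≤ ENNReal.ofReal x := by
  calc _ ≤ ∫⁻ t in Ioi (0 : ℝ), ∫⁻ ω in {ω | t < X ω}, ENNReal.ofReal (ρ ω) ∂P :=
        lintegral_mono fun t => (hX.copula.tailPrice_le hM hX.measurable t).1
    _ = ENNReal.ofReal (∫ ω, ρ ω * X ω ∂P) := by
        rw [← hM.lintegral_kernel_mul hX.measurable hX.nonneg, hM.lintegral_price hX]
    _ ≤ _ := ENNReal.ofReal_le_ofReal hX.budget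

lemma IsMarket.prefValue_le_lintegral [IsProbabilityMeasure m] (hM : IsMarket P ρ A)
    (hm : m (Icc (0 : ℝ) 1) = 1) (X : Ω → ℝ) :
    prefValue P m X ≤
      bestRatio P m ρ A C * ∫⁻ t in Ioi (0 : ℝ), tailPrice P ρ A C (cdf (P.map X) t) := by
  rw [prefValue_eq, ← lintegral_const_mul _ (measurable_tailPrice_cdf _)]
  exact lintegral_mono fun t => hM.tailWeight_le hm (cdf_nonneg _ t)

theorem IsMarket.prefValue_le [IsProbabilityMeasure m] (hM : IsMarket P ρ A)
    (hm : m (Icc (0 : ℝ) 1) = 1) {x : ℝ} {X : Ω → ℝ} (hX : Feasible P ρ A C x X) :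
    prefValue P m X ≤ bestRatio P m ρ A C * ENNReal.ofReal x :=
  (hM.prefValue_le_lintegral hm X).trans (mul_le_mul_right (hM.lintegral_tailPrice_le hX) _)

/-! ### Equality in the upper bound -/

/-- If a payoff attains a finite upper bound, then all the estimates behind the bound are
equalities: almost every layer is null or a digital payoff of optimal ratio, and the whole budget
is spent. -/
theorem IsMarket.of_bound_le_prefValue [IsProbabilityMeasure m] (hM : IsMarket P ρ A)
    (hm : m (Icc (0 : ℝ) 1) = 1) {x : ℝ} {X : Ω → ℝ} (hX : Feasible P ρ A C x X)
    (h0 : bestRatio P m ρ A C ≠ 0)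
    (htop : bestRatio P m ρ A C ≠ ∞)
    (hV : bestRatio P m ρ A C * ENNReal.ofReal x ≤ prefValue P m X) :
    (∀ᵐ t ∂(volume.restrict (Ioi (0 : ℝ))),
      tailWeight m (cdf (P.map X) t) =
        bestRatio P m ρ A C * tailPrice P ρ A C (cdf (P.map X) t)) ∧
    (∀ᵐ t ∂(volume.restrict (Ioi (0 : ℝ))),
      ∀ᵐ ω ∂P, t < X ω ↔ cdf (P.map X) t ≤ zVar P ρ A C ω) ∧
    ∫⁻ ω, ENNReal.ofReal (ρ ω) * ENNReal.ofReal (X ω) ∂P = ENNReal.ofReal x := by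
  have hx : ENNReal.ofReal x ≤ ∫⁻ t in Ioi (0 : ℝ), tailPrice P ρ A C (cdf (P.map X) t) :=
    (ENNReal.mul_le_mul_iff_right h0 htop).1 (hV.trans (hM.prefValue_le_lintegral hm X))
  have hfin : ∫⁻ t in Ioi (0 : ℝ), tailPrice P ρ A C (cdf (P.map X) t) ≠ ∞ :=
    ne_top_of_le_ne_top ENNReal.ofReal_ne_top (hM.lintegral_tailPrice_le hX)
  have hprice : ∫⁻ ω, ENNReal.ofReal (ρ ω) * ENNReal.ofReal (X ω) ∂P ≤ ENNReal.ofReal x := by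
    rw [hM.lintegral_price hX]
    exact ENNReal.ofReal_le_ofReal hX.budget
  have hlayer : Antitone fun t : ℝ => ∫⁻ ω in {ω | t < X ω}, ENNReal.ofReal (ρ ω) ∂P :=
    fun s t hst => lintegral_mono_set fun ω hω => lt_of_le_of_lt hst hω
  refine ⟨?_, ?_, ?_⟩
  · refine ae_eq_of_ae_le_of_lintegral_le
      (ae_of_all _ fun t => hM.tailWeight_le hm (cdf_nonneg _ t)) ?_
      ((measurable_tailPrice_cdf _).const_mul _).aemeasurable ?_
    · rw [← prefValue_eq P m X]
      exact ne_top_of_le_ne_top (ENNReal.mul_ne_top htop ENNReal.ofReal_ne_top)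
        (hM.prefValue_le hm hX)
    · rw [← prefValue_eq P m X, lintegral_const_mul _ (measurable_tailPrice_cdf _)]
      exact (mul_le_mul_right (hM.lintegral_tailPrice_le hX) _).trans hV
  · have heq := ae_eq_of_ae_le_of_lintegral_le
      (ae_of_all _ fun t => (hX.copula.tailPrice_le hM hX.measurable t).1) hfin
      hlayer.measurable.aemeasurable
      (by
        rw [← hM.lintegral_kernel_mul hX.measurable hX.nonneg]
        exact hprice.trans hx)
    filter_upwards [heq] with t ht
    exact ((hX.copula.tailPrice_le hM hX.measurable t).2 ht.ge).mem_iff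
  · refine le_antisymm hprice (hx.trans ?_)
    rw [hM.lintegral_kernel_mul hX.measurable hX.nonneg]
    exact lintegral_mono fun t => (hX.copula.tailPrice_le hM hX.measurable t).1

/-! ### Digital payoffs -/

section Digital

variable {D : Set Ω} {c k : ℝ}

lemma cdf_map_apply {X : Ω → ℝ} (hX : Measurable X) (t : ℝ) :
    cdf (P.map X) t = P.real {ω | X ω ≤ t} := by
  have := Measure.isProbabilityMeasure_map (μ := P) hX.aemeasurable
  rw [cdf_eq_real, map_measureReal_apply hX measurableSet_Iic]
  rfl

lemma IsMarket.measureReal_zVar_le (hM : IsMarket P ρ A) {u : ℝ} (hu : u ∈ Icc (0 : ℝ) 1) :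
    P.real {ω | zVar P ρ A C ω ≤ u} = u := by
  rw [measureReal_def, hM.measure_zVar_le, min_eq_right hu.2, ENNReal.toReal_ofReal hu.1]

/-- The CDF of `k 1_D`, for an event `D` that agrees with `{Z ≥ c}` almost surely. The events
`{k 1_D ≤ t}` are, up to null sets, sublevel events of `Z`, so `k 1_D` has copula `C` with `A`. -/
lemma IsMarket.cdf_digital (hM : IsMarket P ρ A) (hD : MeasurableSet D) (hc : c ∈ Ico (0 : ℝ) 1)
    (hDc : ∀ᵐ ω ∂P, ω ∈ D ↔ c ≤ zVar P ρ A C ω) (hk : 0 < k) (t : ℝ) :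
    cdf (P.map (D.indicator fun _ => k)) t = (if t < 0 then 0 else if t < k then c else 1) ∧
      {ω | D.indicator (fun _ => k) ω ≤ t} =ᵐ[P]
        {ω | zVar P ρ A C ω ≤ if t < 0 then 0 else if t < k then c else 1} := by
  classical
  have hae : {ω | D.indicator (fun _ => k) ω ≤ t} =ᵐ[P]
      {ω | zVar P ρ A C ω ≤ if t < 0 then 0 else if t < k then c else 1} := by
    refine eventuallyEq_set.2 ?_
    filter_upwards [hDc, hM.ae_zVar_ne (C := C) 0, hM.ae_zVar_ne (C := C) c,
      hM.ae_zVar_mem (C := C)] with ω h1 h2 h3 h4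
    simp only [indicator_apply, h1]
    have h5 := h4.1
    have h6 := h4.2
    split_ifs <;> grind
  refine ⟨?_, hae⟩
  rw [cdf_map_apply (measurable_const.indicator hD), measureReal_congr hae]
  refine hM.measureReal_zVar_le ?_
  have := hc.1
  have := hc.2
  split_ifs <;> constructor <;> linarith

lemma IsMarket.feasible_digital (hM : IsMarket P ρ A) (hD : MeasurableSet D)
    (hc : c ∈ Ico (0 : ℝ) 1) (hDc : ∀ᵐ ω ∂P, ω ∈ D ↔ c ≤ zVar P ρ A C ω) (hk : 0 < k) {x : ℝ}
    (hx : (∫ ω in D, ρ ω ∂P) * k ≤ x) : Feasible P ρ A C x (D.indicator fun _ => k) := by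
  have hmul : (fun ω => ρ ω * D.indicator (fun _ => k) ω) = D.indicator fun ω => ρ ω * k := by
    ext ω
    by_cases h : ω ∈ D <;> simp [h]
  refine ⟨measurable_const.indicator hD, ae_of_all _ fun ω => indicator_nonneg (fun _ _ => hk.le) ω,
    ?_, ?_, fun t a => ?_⟩
  · rw [hmul]
    exact (hM.integrable.mul_const k).indicator hD
  · rwa [hmul, integral_indicator hD, integral_mul_const]
  · obtain ⟨h1, h2⟩ := hM.cdf_digital hD hc hDc hk t
    rw [h1, ← hM.measure_zVar_le_inter]
    exact measureReal_congr (h2.inter (ae_eq_refl {ω | A ω ≤ a}))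

lemma IsMarket.prefValue_digital [IsProbabilityMeasure m] (hM : IsMarket P ρ A)
    (hD : MeasurableSet D) (hc : c ∈ Ico (0 : ℝ) 1)
    (hDc : ∀ᵐ ω ∂P, ω ∈ D ↔ c ≤ zVar P ρ A C ω) (hk : 0 < k) :
    prefValue P m (D.indicator fun _ => k) = tailWeight m c * ENNReal.ofReal k := by
  rw [prefValue_eq]
  calc _ = ∫⁻ t in Ioi (0 : ℝ), (Iio k).indicator (fun _ => tailWeight m c) t := by
        refine setLIntegral_congr_fun measurableSet_Ioi fun t ht => ?_
        have ht' : ¬ t < 0 := not_lt.2 (le_of_lt ht)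
        simp only [(hM.cdf_digital hD hc hDc hk t).1, if_neg ht', indicator_apply, mem_Iio]
        split_ifs <;> simp [tailWeight]
    _ = _ := by
        rw [lintegral_indicator measurableSet_Iio, Measure.restrict_restrict measurableSet_Iio,
          setLIntegral_const, Iio_inter_Ioi, Real.volume_Ioo, sub_zero]

end Digital

/-! ### The optimal value -/

variable {x : ℝ}

lemma IsMarket.tailPrice_mul_level (hM : IsMarket P ρ A) {c : ℝ} (hc : c < 1) :
    0 < ∫ ω in {ω | c ≤ zVar P ρ A C ω}, ρ ω ∂P ∧
      tailPrice P ρ A C c *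
        ENNReal.ofReal (x / ∫ ω in {ω | c ≤ zVar P ρ A C ω}, ρ ω ∂P) = ENNReal.ofReal x := by
  have h0 := hM.tailPrice_ne_zero (C := C) hc
  rw [tailPrice, hM.lintegral_ofReal] at h0 ⊢
  have hpos : 0 < ∫ ω in {ω | c ≤ zVar P ρ A C ω}, ρ ω ∂P := by simpa using h0
  rw [← ENNReal.ofReal_mul hpos.le, mul_div_cancel₀ x hpos.ne']
  exact ⟨hpos, rfl⟩

theorem IsMarket.digital_spec [IsProbabilityMeasure m] (hM : IsMarket P ρ A) (hx : 0 < x) {c : ℝ}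
    (hc : c ∈ Ioo (0 : ℝ) 1) :
    Feasible P ρ A C x (digital P ρ A C x c) ∧
      prefValue P m (digital P ρ A C x c) =
        ENNReal.ofReal (zeta P m ρ A C c) * ENNReal.ofReal x := by
  obtain ⟨hpos, hmul⟩ := hM.tailPrice_mul_level (C := C) (x := x) hc.2
  have hD := hM.measurableSet_le_zVar (C := C) c
  have hDc : ∀ᵐ ω ∂P, ω ∈ {ω | c ≤ zVar P ρ A C ω} ↔ c ≤ zVar P ρ A C ω :=
    ae_of_all _ fun ω => Iff.rfl
  have hk := div_pos hx hpos
  refine ⟨hM.feasible_digital hD ⟨hc.1.le, hc.2⟩ hDc hk (mul_div_cancel₀ x hpos.ne').le, ?_⟩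
  rw [digital, hM.prefValue_digital hD ⟨hc.1.le, hc.2⟩ hDc hk, hM.tailWeight_eq_zeta_mul hc,
    mul_assoc, hmul]

theorem IsMarket.const_spec [IsProbabilityMeasure m] (hM : IsMarket P ρ A)
    (hm : m (Icc (0 : ℝ) 1) = 1) (hx : 0 < x) :
    Feasible P ρ A C x (fun _ => x / ∫ ω, ρ ω ∂P) ∧
      prefValue P m (fun _ : Ω => x / ∫ ω, ρ ω ∂P) =
        ENNReal.ofReal (1 / ∫ ω, ρ ω ∂P) * ENNReal.ofReal x := by
  have hpos := hM.integral_pos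
  have hDc : ∀ᵐ ω ∂P, ω ∈ univ ↔ 0 ≤ zVar P ρ A C ω :=
    hM.ae_zVar_mem.mono fun ω h => ⟨fun _ => h.1, fun _ => mem_univ ω⟩
  have hc : (0 : ℝ) ∈ Ico (0 : ℝ) 1 := ⟨le_rfl, one_pos⟩
  have hk := div_pos hx hpos
  have h1 := hM.feasible_digital MeasurableSet.univ hc hDc hk (x := x)
    (by rw [setIntegral_univ, mul_div_cancel₀ x hpos.ne'])
  have h2 := hM.prefValue_digital (m := m) MeasurableSet.univ hc hDc hk
  rw [indicator_univ] at h1 h2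
  refine ⟨h1, ?_⟩
  rw [h2, tailWeight, if_pos one_pos, hm, one_mul, ← ENNReal.ofReal_mul (one_div_pos.2 hpos).le,
    one_div_mul_eq_div]

theorem IsMarket.optimalValue_eq [IsProbabilityMeasure m] (hM : IsMarket P ρ A)
    (hm : m (Icc (0 : ℝ) 1) = 1) (hx : 0 < x) :
    optimalValue P m ρ A C x = bestRatio P m ρ A C * ENNReal.ofReal x := by
  refine le_antisymm (iSup₂_le fun X hX => hM.prefValue_le hm hX) ?_
  have hle : ∀ X, Feasible P ρ A C x X → prefValue P m X ≤ optimalValue P m ρ A C x := fun X hX =>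
    le_iSup₂ (f := fun X (_ : X ∈ {X : Ω → ℝ | Feasible P ρ A C x X}) => prefValue P m X) X hX
  rcases le_total (ENNReal.ofReal (1 / ∫ ω, ρ ω ∂P)) (gammaStar P m ρ A C) with h | h
  · rw [bestRatio, max_eq_right h, gammaStar]
    simp_rw [ENNReal.iSup_mul]
    refine iSup₂_le fun c hc => ?_
    rw [← (hM.digital_spec hx hc).2]
    exact hle _ (hM.digital_spec (m := m) hx hc).1
  · rw [bestRatio, max_eq_left h, ← (hM.const_spec (C := C) hm hx).2]
    exact hle _ (hM.const_spec hm hx).1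

lemma IsMarket.isOptimal_iff [IsProbabilityMeasure m] (hM : IsMarket P ρ A)
    (hm : m (Icc (0 : ℝ) 1) = 1) (hx : 0 < x) {X : Ω → ℝ} :
    IsOptimal P m ρ A C x X ↔
      Feasible P ρ A C x X ∧ prefValue P m X = bestRatio P m ρ A C * ENNReal.ofReal x := by
  refine and_congr_right fun hX => ⟨fun h => ?_, fun h Y hY => h ▸ hM.prefValue_le hm hY⟩
  refine le_antisymm (hM.prefValue_le hm hX) ?_
  rw [← hM.optimalValue_eq hm hx]
  exact iSup₂_le h

/-! ### The structure of optimal payoffs -/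

/-- If digital payoffs beat constants, a level `u` at which the bound on `m([u, 1])` is sharp is
either `1` or a maximiser of `ζ̃`. -/
lemma IsMarket.eq_one_or_isMaximizer [IsProbabilityMeasure m] (hM : IsMarket P ρ A)
    (hm : m (Icc (0 : ℝ) 1) = 1) {u : ℝ} (hu : u ∈ Icc (0 : ℝ) 1)
    (hlt : ENNReal.ofReal (1 / ∫ ω, ρ ω ∂P) < gammaStar P m ρ A C)
    (h : tailWeight m u = bestRatio P m ρ A C * tailPrice P ρ A C u) :
    u = 1 ∨ (u ∈ Ioo (0 : ℝ) 1 ∧ ENNReal.ofReal (zeta P m ρ A C u) = gammaStar P m ρ A C) := by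
  rw [bestRatio, max_eq_right hlt.le] at h
  rcases hu.2.eq_or_lt with h1 | h1
  · exact Or.inl h1
  have hinj : ∀ {a b : ℝ≥0∞}, a * tailPrice P ρ A C u = b * tailPrice P ρ A C u → a = b :=
    (ENNReal.mul_left_inj (hM.tailPrice_ne_zero h1) (hM.tailPrice_ne_top u)).1
  rcases hu.1.eq_or_lt with rfl | h0
  · rw [hM.tailWeight_zero_eq (C := C) hm] at h
    exact absurd (hinj h) hlt.ne
  · rw [hM.tailWeight_eq_zeta_mul (C := C) ⟨h0, h1⟩] at h
    exact Or.inr ⟨⟨h0, h1⟩, hinj h⟩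

/-- Without a maximiser of `ζ̃` an optimal payoff would have no layers at all. -/
theorem IsMarket.not_isOptimal [IsProbabilityMeasure m] (hM : IsMarket P ρ A)
    (hm : m (Icc (0 : ℝ) 1) = 1) (hx : 0 < x)
    (hlt : ENNReal.ofReal (1 / ∫ ω, ρ ω ∂P) < gammaStar P m ρ A C)
    (htop : gammaStar P m ρ A C < ⊤)
    (hno : ¬ ∃ c ∈ Ioo (0 : ℝ) 1, ENNReal.ofReal (zeta P m ρ A C c) = gammaStar P m ρ A C)
    (Y : Ω → ℝ) : ¬ IsOptimal P m ρ A C x Y := fun hY => by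
  obtain ⟨hF, hV⟩ := (hM.isOptimal_iff hm hx).1 hY
  have hbest : bestRatio P m ρ A C = gammaStar P m ρ A C := max_eq_right hlt.le
  have h0 : bestRatio P m ρ A C ≠ 0 := by rw [hbest]; exact (zero_le.trans_lt hlt).ne'
  obtain ⟨hw, -, -⟩ := hM.of_bound_le_prefValue hm hF h0 (hbest ▸ htop.ne) hV.ge
  have hzero : prefValue P m Y = 0 := by
    rw [prefValue_eq, ← lintegral_zero (μ := volume.restrict (Ioi (0 : ℝ)))]
    refine lintegral_congr_ae (hw.mono fun t ht => ?_)
    rcases hM.eq_one_or_isMaximizer hm ⟨cdf_nonneg _ t, cdf_le_one _ t⟩ hlt ht with h | h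
    · simp [tailWeight, h]
    · exact absurd ⟨_, h⟩ hno
  rw [hzero] at hV
  exact mul_ne_zero h0 (ENNReal.ofReal_pos.2 hx).ne' hV.symm

/-- If `c` is the only maximiser of `ζ̃`, then almost every layer of an optimal payoff is null or
`1_{Z ≥ c}`, so the payoff is a multiple of `1_{Z ≥ c}`; the budget determines the multiple. -/
theorem IsMarket.ae_eq_digital [IsProbabilityMeasure m] (hM : IsMarket P ρ A)
    (hm : m (Icc (0 : ℝ) 1) = 1) (hx : 0 < x)
    (hlt : ENNReal.ofReal (1 / ∫ ω, ρ ω ∂P) < gammaStar P m ρ A C)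
    (htop : gammaStar P m ρ A C < ⊤) {c : ℝ} (hc : c ∈ Ioo (0 : ℝ) 1)
    (huniq : ∀ c' ∈ Ioo (0 : ℝ) 1,
      ENNReal.ofReal (zeta P m ρ A C c') = gammaStar P m ρ A C → c' = c)
    {Y : Ω → ℝ} (hY : IsOptimal P m ρ A C x Y) : Y =ᵐ[P] digital P ρ A C x c := by
  obtain ⟨hF, hV⟩ := (hM.isOptimal_iff hm hx).1 hY
  have hbest : bestRatio P m ρ A C = gammaStar P m ρ A C := max_eq_right hlt.le
  have h0 : bestRatio P m ρ A C ≠ 0 := by rw [hbest]; exact (zero_le.trans_lt hlt).ne'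
  obtain ⟨hw, hlayer, hprice⟩ := hM.of_bound_le_prefValue hm hF h0 (hbest ▸ htop.ne) hV.ge
  have hlayer' : ∀ᵐ t ∂(volume.restrict (Ioi (0 : ℝ))), ∀ᵐ ω ∂P,
      t < Y ω ↔ cdf (P.map Y) t = c ∧ c ≤ zVar P ρ A C ω := by
    filter_upwards [hw, hlayer] with t ht htω
    filter_upwards [htω, hM.ae_zVar_mem (C := C), hM.ae_zVar_ne (C := C) 1] with ω h1 h2 h3
    rw [h1]
    rcases hM.eq_one_or_isMaximizer hm ⟨cdf_nonneg _ t, cdf_le_one _ t⟩ hlt ht with h | h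
    · have := lt_of_le_of_ne h2.2 h3
      have := hc.2
      rw [h]
      constructor <;> intro h' <;> [linarith; linarith [h'.1]]
    · simp [huniq _ h.1 h.2]
  have hmeas : MeasurableSet {p : ℝ × Ω |
      p.1 < Y p.2 ↔ cdf (P.map Y) p.1 = c ∧ c ≤ zVar P ρ A C p.2} := by
    have e1 : MeasurableSet {p : ℝ × Ω | p.1 < Y p.2} :=
      measurableSet_lt measurable_fst (hF.measurable.comp measurable_snd)
    have e2 : MeasurableSet {p : ℝ × Ω | cdf (P.map Y) p.1 = c} :=
      measurableSet_eq_fun ((measurable_cdf _).comp measurable_fst) measurable_const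
    have e3 : MeasurableSet {p : ℝ × Ω | c ≤ zVar P ρ A C p.2} :=
      measurableSet_le measurable_const (hM.measurable_zVar.comp measurable_snd)
    have e23 : MeasurableSet {p : ℝ × Ω | cdf (P.map Y) p.1 = c ∧ c ≤ zVar P ρ A C p.2} :=
      e2.inter e3
    exact e1.iff e23
  rw [Measure.ae_ae_comm hmeas] at hlayer'
  -- the common height of the layers
  set K : ℝ≥0∞ := volume.restrict (Ioi (0 : ℝ)) {t | cdf (P.map Y) t = c}
  have hYK : ∀ᵐ ω ∂P, ENNReal.ofReal (Y ω) =
      {ω | c ≤ zVar P ρ A C ω}.indicator (fun _ => K) ω := by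
    filter_upwards [hlayer'] with ω hω
    have hvol : ENNReal.ofReal (Y ω) = volume.restrict (Ioi (0 : ℝ)) (Iio (Y ω)) := by
      rw [Measure.restrict_apply measurableSet_Iio, Iio_inter_Ioi, Real.volume_Ioo, sub_zero]
    rw [hvol]
    by_cases hz : ω ∈ {ω | c ≤ zVar P ρ A C ω}
    · have hz' : c ≤ zVar P ρ A C ω := hz
      rw [indicator_of_mem hz]
      exact measure_congr (eventuallyEq_set.2 (hω.mono fun t ht => by simpa [hz'] using ht))
    · have hz' : ¬ c ≤ zVar P ρ A C ω := hz
      rw [indicator_of_notMem hz]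
      exact measure_eq_zero_iff_ae_notMem.2 (hω.mono fun t ht => by simpa [hz'] using ht)
  have hK : tailPrice P ρ A C c * K = ENNReal.ofReal x := by
    rw [← hprice, tailPrice, ← lintegral_mul_const _ hM.measurable_kernel.ennreal_ofReal,
      ← lintegral_indicator (hM.measurableSet_le_zVar c)]
    refine lintegral_congr_ae (hYK.mono fun ω hω => ?_)
    beta_reduce
    rw [hω]
    by_cases hz : ω ∈ {ω | c ≤ zVar P ρ A C ω}
    · rw [indicator_of_mem hz, indicator_of_mem hz]
    · rw [indicator_of_notMem hz, indicator_of_notMem hz, mul_zero]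
  obtain ⟨hpos, hmul⟩ := hM.tailPrice_mul_level (C := C) (x := x) hc.2
  have hKeq := (ENNReal.mul_right_inj (hM.tailPrice_ne_zero hc.2) (hM.tailPrice_ne_top c)).1
    (hK.trans hmul.symm)
  filter_upwards [hYK, hF.nonneg] with ω h1 h2
  rw [digital]
  by_cases hz : ω ∈ {ω | c ≤ zVar P ρ A C ω}
  · rw [indicator_of_mem hz, hKeq] at h1
    rw [indicator_of_mem hz]
    exact (ENNReal.ofReal_eq_ofReal_iff h2 (div_pos hx hpos).le).1 h1
  · rw [indicator_of_notMem hz] at h1 ⊢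
    exact le_antisymm (ENNReal.ofReal_eq_zero.1 h1) h2

/-- The ratio `ζ̃` is bounded on `(0, b]` for every `b < 1`, so it can only blow up at `1`. -/
theorem IsMarket.exists_tendsto_top [IsProbabilityMeasure m] (hM : IsMarket P ρ A)
    (htop : gammaStar P m ρ A C = ⊤) :
    ∃ c : ℕ → ℝ, (∀ n, c n ∈ Ioo (0 : ℝ) 1) ∧ Tendsto c atTop (𝓝 1) ∧
      Tendsto (fun n => ENNReal.ofReal (zeta P m ρ A C (c n))) atTop (𝓝 ⊤) := by
  have hex : ∀ n : ℕ, ∃ c ∈ Ioo (0 : ℝ) 1, (n : ℝ≥0∞) < ENNReal.ofReal (zeta P m ρ A C c) := by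
    intro n
    have : (n : ℝ≥0∞) < gammaStar P m ρ A C := htop ▸ ENNReal.natCast_lt_top n
    obtain ⟨c, hc⟩ := lt_iSup_iff.1 this
    obtain ⟨hc', h⟩ := lt_iSup_iff.1 hc
    exact ⟨c, hc', h⟩
  choose c hc hcn using hex
  refine ⟨c, hc, tendsto_order.2 ⟨fun b hb => ?_, fun b hb => ?_⟩,
    tendsto_nhds_top_mono' ENNReal.tendsto_nat_nhds_top fun n => (hcn n).le⟩
  · have hne : (tailPrice P ρ A C b)⁻¹ ≠ ⊤ := ENNReal.inv_ne_top.2 (hM.tailPrice_ne_zero hb)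
    obtain ⟨N, hN⟩ := ENNReal.exists_nat_gt hne
    filter_upwards [eventually_ge_atTop N] with n hn
    by_contra! hle
    have h1 : ENNReal.ofReal (zeta P m ρ A C (c n)) ≤ (tailPrice P ρ A C b)⁻¹ := by
      rw [hM.ofReal_zeta (hc n), ← one_div]
      exact ENNReal.div_le_div prob_le_one (antitone_tailPrice hle)
    have h2 : (N : ℝ≥0∞) ≤ n := by exact_mod_cast hn
    exact ((hN.trans_le h2).trans ((hcn n).trans_le h1)).false
  · exact Eventually.of_forall fun n => (hc n).2.trans hb

end DualPayoff

open DualPayoff in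
theorem theorem2 {Ω : Type*} [MeasurableSpace Ω] (P : Measure Ω) [IsProbabilityMeasure P]
    (m : Measure ℝ) [IsProbabilityMeasure m] (hm : m (Icc (0 : ℝ) 1) = 1)
    (ρ A : Ω → ℝ) (hρ_meas : Measurable ρ) (hρ_pos : ∀ᵐ ω ∂P, 0 < ρ ω) (hρ_int : Integrable ρ P)
    (hA_meas : Measurable A) (C : Copula) (x : ℝ) (hx : 0 < x)
    (hρA : ∀ᵐ a ∂(P.map A), Continuous fun r => condCdf P ρ A r a)
    (hA : Continuous fun a => cdf (P.map A) a)
    (δ : ℝ) (hδ : δ = ∫ ω, ρ ω ∂P) :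
    optimalValue P m ρ A C x
        = max (ENNReal.ofReal (1 / δ)) (gammaStar P m ρ A C) * ENNReal.ofReal x ∧
    -- (i)
    (gammaStar P m ρ A C = ⊤ →
      ∃ c : ℕ → ℝ, (∀ n, c n ∈ Ioo (0 : ℝ) 1) ∧ Tendsto c atTop (𝓝 1) ∧
        (∀ n, Feasible P ρ A C x (digital P ρ A C x (c n))) ∧
        Tendsto (fun n => prefValue P m (digital P ρ A C x (c n))) atTop (𝓝 ⊤)) ∧
    -- (ii)
    (gammaStar P m ρ A C ≤ ENNReal.ofReal (1 / δ) →
      IsOptimal P m ρ A C x (fun _ => x / δ)) ∧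
    -- (iii)
    (ENNReal.ofReal (1 / δ) < gammaStar P m ρ A C → gammaStar P m ρ A C < ⊤ →
      ∀ c ∈ Ioo (0 : ℝ) 1, ENNReal.ofReal (zeta P m ρ A C c) = gammaStar P m ρ A C →
        IsOptimal P m ρ A C x (digital P ρ A C x c) ∧
        ((∀ c' ∈ Ioo (0 : ℝ) 1,
            ENNReal.ofReal (zeta P m ρ A C c') = gammaStar P m ρ A C → c' = c) →
          ∀ Y : Ω → ℝ, IsOptimal P m ρ A C x Y → Y =ᵐ[P] digital P ρ A C x c)) ∧
    -- (iv)
    (ENNReal.ofReal (1 / δ) < gammaStar P m ρ A C → gammaStar P m ρ A C < ⊤ →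
      (¬ ∃ c ∈ Ioo (0 : ℝ) 1, ENNReal.ofReal (zeta P m ρ A C c) = gammaStar P m ρ A C) →
        (¬ ∃ Y : Ω → ℝ, IsOptimal P m ρ A C x Y) ∧
        ∀ c : ℕ → ℝ, (∀ n, c n ∈ Ioo (0 : ℝ) 1) →
          Tendsto (fun n => ENNReal.ofReal (zeta P m ρ A C (c n))) atTop
            (𝓝 (gammaStar P m ρ A C)) →
          (∀ n, Feasible P ρ A C x (digital P ρ A C x (c n))) ∧
          Tendsto (fun n => prefValue P m (digital P ρ A C x (c n))) atTop
            (𝓝 (optimalValue P m ρ A C x))) := by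

  subst hδ
  have hM : IsMarket P ρ A := ⟨hρ_meas, hρ_pos, hρ_int, hA_meas, hρA, hA⟩
  have hx' : ENNReal.ofReal x ≠ 0 := (ENNReal.ofReal_pos.2 hx).ne'
  have hlim : ∀ c : ℕ → ℝ, (∀ n, c n ∈ Ioo (0 : ℝ) 1) →
      Tendsto (fun n => ENNReal.ofReal (zeta P m ρ A C (c n))) atTop (𝓝 (gammaStar P m ρ A C)) →
      Tendsto (fun n => prefValue P m (digital P ρ A C x (c n))) atTop
        (𝓝 (gammaStar P m ρ A C * ENNReal.ofReal x)) := fun c hc h => by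
    simp_rw [fun n => (hM.digital_spec (m := m) (C := C) hx (hc n)).2]
    exact ENNReal.Tendsto.mul_const h (Or.inr ENNReal.ofReal_ne_top)
  refine ⟨hM.optimalValue_eq hm hx, fun htop => ?_, fun hle => ?_,
    fun hlt htop c hc hatt => ⟨?_, fun huniq Y hY => ?_⟩, fun hlt htop hno => ⟨?_, ?_⟩⟩
  · obtain ⟨c, hc, h1, h2⟩ := hM.exists_tendsto_top htop
    refine ⟨c, hc, h1, fun n => (hM.digital_spec (m := m) hx (hc n)).1, ?_⟩
    have := hlim c hc (htop ▸ h2)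
    rwa [htop, ENNReal.top_mul hx'] at this
  · refine (hM.isOptimal_iff hm hx).2 ⟨(hM.const_spec hm hx).1, ?_⟩
    rw [(hM.const_spec (C := C) hm hx).2, bestRatio, max_eq_left hle]
  · refine (hM.isOptimal_iff hm hx).2 ⟨(hM.digital_spec (m := m) hx hc).1, ?_⟩
    rw [(hM.digital_spec hx hc).2, hatt, bestRatio, max_eq_right hlt.le]
  · exact hM.ae_eq_digital hm hx hlt htop hc huniq hY
  · rintro ⟨Y, hY⟩
    exact hM.not_isOptimal hm hx hlt htop hno Y hY
  · intro c hc h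
    refine ⟨fun n => (hM.digital_spec (m := m) hx (hc n)).1, ?_⟩
    rw [hM.optimalValue_eq hm hx, bestRatio, max_eq_right hlt.le]
    exact hlim c hc h
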